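/- For a subring $R\subset\mathbb{Q}$, let $\Omega^R$ be the class of group homomorphisms $\alpha\colon\pi\to G$ such that $\pi$ is finitely generated, $G$ is finitely presented, and $\alpha$ is 2-connected on $R$-homology, that is, $\alpha$ induces an isomorphism $H_1(\pi;R)\to H_1(G;R)$ and a surjection $H_2(\pi;R)\to H_2(G;R)$ on group homology with trivial coefficients $R$. Let $\mathcal{G}$ be the category of groups. **Theorem.** For any subring $R$ of $\mathbb{Q}$ there is a pair $(E,i)$ of a functor $E\colon\mathcal{G}\to\mathcal{G}$ and a natural transformation $i\colon \mathrm{id}_{\mathcal{G}}\to E$ with the following properties. 1. For every $\alpha\colon\pi\to G$ in $\Omega^R$, the induced homomorphism $E(\alpha)\colon E(\pi)\to E(G)$ is an isomorphism. 2. For every finitely presented group $G$ there is a sequence $G=G_0\to G_1\to\cdots\to G_k\to\cdots$ of finitely presented groups and homomorphisms $G_k\to G_{k+1}$ in $\Omega^R$ such that $E(G)=\varinjlim G_k$ and $i_G\colon G\to E(G)$ is the limit homomorphism $G=G_0\to\varinjlim G_k$. -/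

import Mathlib

open CategoryTheory

universe u

/-- The morphism of trivial coefficients `k ⟶ res f k` over a group homomorphism `f : G →* H`,
given by the identity of `k`. -/
noncomputable def trivialCoeffHom (k : Type u) [CommRing k] {G H : Type u} [Group G] [Group H]
    (f : G →* H) : Rep.trivial k G k ⟶ Rep.res f (Rep.trivial k H k) :=
  Rep.ofHom ⟨LinearMap.id, fun _ => rfl⟩

/-- The map `H_n(f; k) : H_n(G; k) ⟶ H_n(H; k)` induced by a group homomorphism `f` on group
homology with (untwisted) coefficients in `k`. -/
noncomputable def groupHomologyMap (k : Type u) [CommRing k] {G H : Type u} [Group G] [Group H]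
    (f : G →* H) (n : ℕ) :
    groupHomology (Rep.trivial k G k) n ⟶ groupHomology (Rep.trivial k H k) n :=
  groupHomology.map f (trivialCoeffHom k f) n

/-- A group homomorphism is 2-connected on `R`-homology if it induces an isomorphism on
`H_1(-; R)` and a surjection on `H_2(-; R)`. The `ULift` only moves the coefficient ring
`R ⊆ ℚ` to the universe of the groups. -/
def IsTwoConnected (R : Subring ℚ) {G H : Type u} [Group G] [Group H] (f : G →* H) : Prop :=
  Function.Bijective (groupHomologyMap (ULift.{u} R) f 1) ∧
    Function.Surjective (groupHomologyMap (ULift.{u} R) f 2)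

/-- The class `Ω^R` of group homomorphisms `α : π ⟶ G` with `π` finitely generated, `G` finitely
presented, and `α` 2-connected on `R`-homology. -/
def OmegaR (R : Subring ℚ) : MorphismProperty GrpCat.{u} := fun π G α =>
  Group.FG π ∧ Group.IsFinitelyPresented G ∧ IsTwoConnected R α.hom

/-!
The closure functor is localization with respect to systems of equations. A *system* over `G` has
the form `x_j ^ e_j = w_j(x)` with `e_j` invertible in `R` and every variable of total exponent zero
in `w_j`; a group is *closed* if every system over it has exactly one solution, and `E(G)` is the
initial closed group under `G`. It exists because being closed is described by operations (the
solutions of systems) subject to implications: `E(G)` is the set of formal expressions in elements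
of `G`, the group operations and solutions of systems, modulo having equal values in every closed
group under `G` (`RClosure`, `RClosure.isRClosed`, `RClosure.hom_ext`).

The link with homology is that 2-connectedness on `R`-homology can be tested on central extensions
by `R`-modules. If a homomorphism `φ : G → H` lifts uniquely to such extensions of `H`, then it is
2-connected (`HasUniqueCentralLifts.isTwoConnected`): one applies the lifting property to the
cokernels of the mapping cone of `φ` on bar complexes. Solutions of a system lift uniquely along
these extensions, since a central change of the variables alters the left-hand sides bijectively and
the right-hand sides not at all (`SystemShape.existsUnique_isSolution_lift`). Hence both adjoining
a solution to a system and identifying two of its solutions are 2-connected.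

Conversely a 2-connected `φ : π → G` with `π` finitely generated and `G` finitely presented induces
a bijection on homomorphisms to a closed group (`IsRClosed.bijective_comp`). Surjectivity on
first homology shows that generators of `G` solve a system over `π`; adjoining its solution to `π`
yields a group `P` with a 2-connected surjection `P → G`, whose kernel `K` is normally generated by
finitely many elements. Stallings' exact sequence shows that `K / [K, P]` is torsion of order
invertible in `R`, so that these generators solve a system that is also solved by the trivial
tuple, and uniqueness of solutions makes them trivial in every closed group. Thus `E` inverts `φ`.

For a finitely presented, hence countable, `G` there are countably many systems over `G`. A
diagonal enumeration gives a sequence of 2-connected maps between finitely presented groups along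
which every system over every stage acquires a solution and any two solutions become equal
(`exists_solving_sequence`). Its colimit is closed, and homomorphisms from `G` to closed groups
extend uniquely to it, so it is `E(G)`.
-/

/-! ### Low-dimensional chains -/

section Chains

variable (k : Type u) [CommRing k]

/-- The boundary `k[G²] → k[G]` of the bar complex with trivial coefficients. -/
noncomputable def barBoundary₂ (G : Type u) [Group G] : (G × G →₀ k) →ₗ[k] (G →₀ k) :=
  Finsupp.linearCombination k fun x =>
    Finsupp.single x.2 1 - Finsupp.single (x.1 * x.2) 1 + Finsupp.single x.1 1

/-- The boundary `k[G³] → k[G²]` of the bar complex with trivial coefficients. -/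
noncomputable def barBoundary₃ (G : Type u) [Group G] : (G × G × G →₀ k) →ₗ[k] (G × G →₀ k) :=
  Finsupp.linearCombination k fun x =>
    Finsupp.single (x.2.1, x.2.2) 1 - Finsupp.single (x.1 * x.2.1, x.2.2) 1 +
      Finsupp.single (x.1, x.2.1 * x.2.2) 1 - Finsupp.single (x.1, x.2.1) 1

variable {k} {G H : Type u} [Group G] [Group H]

@[simp]
lemma barBoundary₂_single (x y : G) (a : k) :
    barBoundary₂ k G (Finsupp.single (x, y) a) =
      Finsupp.single y a - Finsupp.single (x * y) a + Finsupp.single x a := by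
  simp [barBoundary₂, smul_sub, smul_add]

@[simp]
lemma barBoundary₃_single (x y z : G) (a : k) :
    barBoundary₃ k G (Finsupp.single (x, y, z) a) =
      Finsupp.single (y, z) a - Finsupp.single (x * y, z) a + Finsupp.single (x, y * z) a -
        Finsupp.single (x, y) a := by
  simp [barBoundary₃, smul_sub, smul_add]

lemma groupHomology_d₂₁_trivial (z : G × G →₀ k) :
    groupHomology.d₂₁ (Rep.trivial k G k) z = barBoundary₂ k G z := by
  suffices h : (groupHomology.d₂₁ (Rep.trivial k G k)).hom = barBoundary₂ k G from
    congrArg (fun F => F z) h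
  ext x : 2
  simp [groupHomology.d₂₁, barBoundary₂]

lemma groupHomology_d₃₂_trivial (z : G × G × G →₀ k) :
    groupHomology.d₃₂ (Rep.trivial k G k) z = barBoundary₃ k G z := by
  suffices h : (groupHomology.d₃₂ (Rep.trivial k G k)).hom = barBoundary₃ k G from
    congrArg (fun F => F z) h
  ext x : 2
  simp [groupHomology.d₃₂, barBoundary₃]

lemma chainsMap₁_trivial (f : G →* H) (c : G →₀ k) :
    groupHomology.chainsMap₁ f (trivialCoeffHom k f) c = Finsupp.mapDomain f c := by
  exact Finsupp.mapRange_id (Finsupp.mapDomain f c)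

lemma chainsMap₂_trivial (f : G →* H) (c : G × G →₀ k) :
    groupHomology.chainsMap₂ f (trivialCoeffHom k f) c =
      Finsupp.mapDomain (Prod.map f f) c := by
  exact Finsupp.mapRange_id (Finsupp.mapDomain (Prod.map f f) c)

lemma barBoundary₂_mapDomain (f : G →* H) (z : G × G →₀ k) :
    barBoundary₂ k H (Finsupp.mapDomain (Prod.map f f) z) =
      Finsupp.mapDomain f (barBoundary₂ k G z) := by
  induction z using Finsupp.induction_linear with
  | zero => simp
  | add a b ha hb => simp only [Finsupp.mapDomain_add, map_add, ha, hb]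
  | single x a =>
    obtain ⟨x, y⟩ := x
    have hsub (u v : G →₀ k) : Finsupp.mapDomain f (u - v) =
        Finsupp.mapDomain f u - Finsupp.mapDomain f v :=
      map_sub (Finsupp.lmapDomain k k f) u v
    simp [Finsupp.mapDomain_single, Finsupp.mapDomain_add, hsub]

lemma groupHomologyMap_one_H1π (f : G →* H) (c : G →₀ k)
    (hc : c ∈ groupHomology.cycles₁ (Rep.trivial k G k))
    (hc' : Finsupp.mapDomain f c ∈ groupHomology.cycles₁ (Rep.trivial k H k)) :
    groupHomologyMap k f 1 (groupHomology.H1π _ ⟨c, hc⟩) =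
      groupHomology.H1π _ ⟨Finsupp.mapDomain f c, hc'⟩ := by
  have h := congrArg (fun F => F.hom ⟨c, hc⟩)
    (groupHomology.H1π_comp_map f (trivialCoeffHom k f))
  refine h.trans ?_
  refine congrArg (groupHomology.H1π (Rep.trivial k H k)) (Subtype.ext ?_)
  exact chainsMap₁_trivial f c

lemma groupHomologyMap_two_H2π (f : G →* H) (c : G × G →₀ k)
    (hc : c ∈ groupHomology.cycles₂ (Rep.trivial k G k))
    (hc' : Finsupp.mapDomain (Prod.map f f) c ∈ groupHomology.cycles₂ (Rep.trivial k H k)) :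
    groupHomologyMap k f 2 (groupHomology.H2π (Rep.trivial k G k) ⟨c, hc⟩) =
      groupHomology.H2π (Rep.trivial k H k) ⟨Finsupp.mapDomain (Prod.map f f) c, hc'⟩ := by
  have h := congrArg (fun F => F.hom ⟨c, hc⟩)
    (groupHomology.H2π_comp_map f (trivialCoeffHom k f))
  refine h.trans ?_
  refine congrArg (groupHomology.H2π (Rep.trivial k H k)) (Subtype.ext ?_)
  exact chainsMap₂_trivial f c

lemma mem_cycles₁_trivial (c : G →₀ k) : c ∈ groupHomology.cycles₁ (Rep.trivial k G k) := by
  rw [groupHomology.cycles₁_eq_top_of_isTrivial]; trivial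

lemma mem_cycles₂_trivial (c : G × G →₀ k) :
    c ∈ groupHomology.cycles₂ (Rep.trivial k G k) ↔ barBoundary₂ k G c = 0 := by
  rw [← groupHomology_d₂₁_trivial]; rfl

lemma groupHomologyMap_one_surjective_iff (f : G →* H) :
    Function.Surjective (groupHomologyMap k f 1) ↔
      ∀ c : H →₀ k, ∃ (b : G →₀ k) (z : H × H →₀ k),
        c = Finsupp.mapDomain f b + barBoundary₂ k H z := by
  constructor
  · intro h c
    obtain ⟨b, hb⟩ := h (groupHomology.H1π _ ⟨c, mem_cycles₁_trivial c⟩)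
    induction b using groupHomology.H1_induction_on with
    | h b =>
    obtain ⟨b, hb'⟩ := b
    rw [groupHomologyMap_one_H1π f b hb' (mem_cycles₁_trivial _)] at hb
    obtain ⟨z, hz⟩ := (groupHomology.H1π_eq_iff _ _).1 hb.symm
    refine ⟨b, z, ?_⟩
    rw [← groupHomology_d₂₁_trivial]
    exact (add_eq_of_eq_sub' hz).symm
  · intro h x
    induction x using groupHomology.H1_induction_on with
    | h c =>
    obtain ⟨c, hc⟩ := c
    obtain ⟨b, z, hbz⟩ := h c
    refine ⟨groupHomology.H1π _ ⟨b, mem_cycles₁_trivial b⟩, ?_⟩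
    rw [groupHomologyMap_one_H1π f b _ (mem_cycles₁_trivial _)]
    refine ((groupHomology.H1π_eq_iff _ _).2 ⟨z, ?_⟩).symm
    refine (groupHomology_d₂₁_trivial z).trans ?_
    exact eq_sub_of_add_eq' hbz.symm

lemma groupHomologyMap_one_injective_iff (f : G →* H) :
    Function.Injective (groupHomologyMap k f 1) ↔
      ∀ (c : G →₀ k) (z : H × H →₀ k), Finsupp.mapDomain f c = barBoundary₂ k H z →
        ∃ z', c = barBoundary₂ k G z' := by
  have key : Function.Injective (groupHomologyMap k f 1) ↔
      ∀ x, groupHomologyMap k f 1 x = 0 → x = 0 :=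
    injective_iff_map_eq_zero (groupHomologyMap k f 1).hom
  rw [key]
  constructor
  · intro h c z hcz
    have := h (groupHomology.H1π _ ⟨c, mem_cycles₁_trivial c⟩) (by
      rw [groupHomologyMap_one_H1π f c _ (mem_cycles₁_trivial _),
        groupHomology.H1π_eq_zero_iff]
      exact ⟨z, (groupHomology_d₂₁_trivial z).trans hcz.symm⟩)
    rw [groupHomology.H1π_eq_zero_iff] at this
    obtain ⟨z', hz'⟩ := this
    exact ⟨z', (groupHomology_d₂₁_trivial z' ▸ hz').symm⟩
  · intro h x hx
    induction x using groupHomology.H1_induction_on with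
    | h c =>
    obtain ⟨c, hc⟩ := c
    rw [groupHomologyMap_one_H1π f c _ (mem_cycles₁_trivial _),
        groupHomology.H1π_eq_zero_iff] at hx
    obtain ⟨z, hz⟩ := hx
    obtain ⟨z', hz'⟩ := h c z ((groupHomology_d₂₁_trivial z).symm.trans hz).symm
    rw [groupHomology.H1π_eq_zero_iff]
    exact ⟨z', (groupHomology_d₂₁_trivial z').trans hz'.symm⟩

lemma groupHomologyMap_two_surjective_iff (f : G →* H) :
    Function.Surjective (groupHomologyMap k f 2) ↔
      ∀ c : H × H →₀ k, barBoundary₂ k H c = 0 → ∃ (b : G × G →₀ k) (y : H × H × H →₀ k),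
        barBoundary₂ k G b = 0 ∧ c = Finsupp.mapDomain (Prod.map f f) b + barBoundary₃ k H y := by
  have map_mem (b : G × G →₀ k) (hb : barBoundary₂ k G b = 0) :
      Finsupp.mapDomain (Prod.map f f) b ∈ groupHomology.cycles₂ (Rep.trivial k H k) := by
    rw [mem_cycles₂_trivial, barBoundary₂_mapDomain, hb, Finsupp.mapDomain_zero]
  constructor
  · intro h c hc
    obtain ⟨b, hb⟩ := h (groupHomology.H2π _ ⟨c, (mem_cycles₂_trivial c).2 hc⟩)
    induction b using groupHomology.H2_induction_on with
    | h b =>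
    obtain ⟨b, hb'⟩ := b
    have hb₀ := (mem_cycles₂_trivial b).1 hb'
    rw [groupHomologyMap_two_H2π f b hb' (map_mem b hb₀)] at hb
    obtain ⟨z, hz⟩ := (groupHomology.H2π_eq_iff _ _).1 hb.symm
    refine ⟨b, z, hb₀, ?_⟩
    rw [← groupHomology_d₃₂_trivial]
    exact (add_eq_of_eq_sub' hz).symm
  · intro h x
    induction x using groupHomology.H2_induction_on with
    | h c =>
    obtain ⟨c, hc⟩ := c
    obtain ⟨b, z, hb, hbz⟩ := h c ((mem_cycles₂_trivial c).1 hc)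
    refine ⟨groupHomology.H2π _ ⟨b, (mem_cycles₂_trivial b).2 hb⟩, ?_⟩
    rw [groupHomologyMap_two_H2π f b _ (map_mem b hb)]
    refine ((groupHomology.H2π_eq_iff _ _).2 ⟨z, ?_⟩).symm
    refine (groupHomology_d₃₂_trivial z).trans ?_
    exact eq_sub_of_add_eq' hbz.symm

lemma groupHomologyMap_comp {K : Type u} [Group K] (f : G →* H) (g : H →* K) (n : ℕ) :
    groupHomologyMap k (g.comp f) n = groupHomologyMap k f n ≫ groupHomologyMap k g n :=
  groupHomology.map_comp f g (trivialCoeffHom k f) (trivialCoeffHom k g) n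

end Chains

section TwoConnected

variable {R : Subring ℚ} {G H K : Type u} [Group G] [Group H] [Group K]

lemma IsTwoConnected.of_comp {f : G →* H} {g : H →* K} (hgf : IsTwoConnected R (g.comp f))
    (hf : IsTwoConnected R f) : IsTwoConnected R g := by
  unfold IsTwoConnected at *
  simp only [groupHomologyMap_comp] at hgf
  have h1 : Function.Bijective (groupHomologyMap (ULift.{u} R) g 1 ∘
    groupHomologyMap (ULift.{u} R) f 1) := by simpa using hgf.1
  have h2 : Function.Surjective (groupHomologyMap (ULift.{u} R) g 2 ∘
    groupHomologyMap (ULift.{u} R) f 2) := by simpa using hgf.2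
  exact ⟨(Function.Bijective.of_comp_iff _ hf.1).1 h1, h2.of_comp⟩

end TwoConnected

/-! ### Central extensions detect 2-connectedness -/

/-- The multiplicative set of integers that are invertible in `R`. -/
def invertibleIntegers (R : Subring ℚ) : Submonoid ℤ :=
  (IsUnit.submonoid R).comap (Int.castRingHom R)

lemma mem_invertibleIntegers {R : Subring ℚ} {e : ℤ} :
    e ∈ invertibleIntegers R ↔ IsUnit (e : R) := Iff.rfl

lemma bijective_zsmul_of_mem_invertibleIntegers {R : Subring ℚ} {A : Type*} [AddCommGroup A]
    [Module (ULift.{u} R) A] {e : ℤ} (he : e ∈ invertibleIntegers R) :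
    Function.Bijective fun a : A => e • a := by
  have hu : IsUnit (e : ULift.{u} R) := by
    simpa using (mem_invertibleIntegers.1 he).map (ULift.ringEquiv (R := R)).symm
  have h := (Module.End.isUnit_iff _).1 (hu.map (algebraMap (ULift.{u} R)
    (Module.End (ULift.{u} R) A)))
  convert h using 2 with a
  simp

/-- A surjection `p` with central kernel on which every integer invertible in `R` acts
bijectively; equivalently, a central extension whose kernel is an `R`-module. -/
structure IsCentralExtension (R : Subring ℚ) {E H : Type*} [Group E] [Group H] (p : E →* H) :
    Prop where
  surjective : Function.Surjective p
  central : ∀ a, p a = 1 → ∀ b, a * b = b * a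
  divisible : ∀ e ∈ invertibleIntegers R, ∀ a, p a = 1 → ∃! b, p b = 1 ∧ b ^ e = a

/-- `φ : G → H` lifts uniquely to central extensions of `H` by `R`-modules: whenever such an
extension is given a splitting over `G`, there is a unique compatible splitting over `H`. -/
def HasUniqueCentralLifts (R : Subring ℚ) {G H : Type u} [Group G] [Group H] (φ : G →* H) : Prop :=
  ∀ (E : Type u) [Group E] (p : E →* H), IsCentralExtension R p →
    ∀ s : G →* E, p.comp s = φ → ∃! t : H →* E, p.comp t = MonoidHom.id H ∧ t.comp φ = s

section CocycleExtension

variable {H A : Type*} [Group H] [AddCommGroup A]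

/-- Inhomogeneous 2-cocycles with trivial coefficients, not necessarily normalized. -/
def IsTrivialCocycle (f : H → H → A) : Prop :=
  ∀ x y z, f x y + f (x * y) z = f y z + f x (y * z)

lemma IsTrivialCocycle.one_left {f : H → H → A} (hf : IsTrivialCocycle f) (x : H) :
    f 1 x = f 1 1 := by
  have := hf 1 1 x
  simpa using this.symm

lemma IsTrivialCocycle.one_right {f : H → H → A} (hf : IsTrivialCocycle f) (x : H) :
    f x 1 = f 1 1 := by
  have := hf x 1 1
  simpa using this

/-- The central extension of `H` by `A` attached to a 2-cocycle: the set `A × H` with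
multiplication twisted by the cocycle. -/
@[ext]
structure CocycleExtension {f : H → H → A} (hf : IsTrivialCocycle f) where
  /-- The coordinate in the kernel. -/
  fst : A
  /-- The coordinate in the quotient. -/
  snd : H

namespace CocycleExtension

variable {f : H → H → A} (hf : IsTrivialCocycle f)

instance : Mul (CocycleExtension hf) := ⟨fun x y => ⟨x.fst + y.fst + f x.snd y.snd, x.snd * y.snd⟩⟩

instance : One (CocycleExtension hf) := ⟨⟨-f 1 1, 1⟩⟩

instance : Inv (CocycleExtension hf) := ⟨fun x => ⟨-x.fst - f x.snd⁻¹ x.snd - f 1 1, x.snd⁻¹⟩⟩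

@[simp] lemma mul_fst (x y : CocycleExtension hf) :
    (x * y).fst = x.fst + y.fst + f x.snd y.snd := rfl

@[simp] lemma mul_snd (x y : CocycleExtension hf) : (x * y).snd = x.snd * y.snd := rfl

@[simp] lemma one_fst : (1 : CocycleExtension hf).fst = -f 1 1 := rfl

@[simp] lemma one_snd : (1 : CocycleExtension hf).snd = 1 := rfl

@[simp] lemma inv_fst (x : CocycleExtension hf) :
    x⁻¹.fst = -x.fst - f x.snd⁻¹ x.snd - f 1 1 := rfl

@[simp] lemma inv_snd (x : CocycleExtension hf) : x⁻¹.snd = x.snd⁻¹ := rfl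

instance : Group (CocycleExtension hf) :=
  Group.ofLeftAxioms
    (fun x y z => by
      ext
      · have := hf x.snd y.snd z.snd
        simp only [mul_fst, mul_snd]
        rw [add_assoc (x.fst + y.fst + _), add_comm z.fst, ← add_assoc, add_assoc (x.fst + y.fst),
          this]
        abel
      · simp [mul_assoc])
    (fun x => by
      ext
      · simp only [mul_fst, one_fst, one_snd, hf.one_left x.snd]
        abel
      · simp)
    (fun x => by
      ext
      · simp only [mul_fst, one_fst, inv_fst, inv_snd]
        abel
      · simp)

/-- The projection of the extension onto its quotient. -/
def proj : CocycleExtension hf →* H where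
  toFun := snd
  map_one' := rfl
  map_mul' _ _ := rfl

/-- The inclusion of the kernel of the extension. -/
def incl : Multiplicative A →* CocycleExtension hf where
  toFun a := ⟨a.toAdd - f 1 1, 1⟩
  map_one' := by ext <;> simp
  map_mul' a b := by
    ext
    · simp
      abel
    · simp

lemma incl_injective : Function.Injective (incl hf) := fun a b h => by
  simpa [incl] using congrArg fst h

lemma exists_eq_incl {x : CocycleExtension hf} (hx : proj hf x = 1) : ∃ a, x = incl hf a :=
  ⟨Multiplicative.ofAdd (x.fst + f 1 1), by ext <;> simp [incl]; exact hx⟩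

lemma isCentralExtension_proj {R : Subring ℚ} [Module (ULift.{u} R) A] :
    IsCentralExtension R (proj hf) where
  surjective x := ⟨⟨0, x⟩, rfl⟩
  central a ha b := by
    obtain ⟨a, rfl⟩ := exists_eq_incl hf ha
    ext
    · simp only [incl, MonoidHom.coe_mk, OneHom.coe_mk, mul_fst, hf.one_left b.snd,
        hf.one_right b.snd]
      abel
    · simp [incl]
  divisible e he a ha := by
    obtain ⟨a, rfl⟩ := exists_eq_incl hf ha
    obtain ⟨b, hb, hbu⟩ :=
      (bijective_zsmul_of_mem_invertibleIntegers.{u} (A := A) he).existsUnique a.toAdd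
    refine ⟨incl hf (Multiplicative.ofAdd b), ⟨rfl, ?_⟩, ?_⟩
    · rw [← map_zpow, ← ofAdd_zsmul]
      exact congrArg (incl hf) (congrArg Multiplicative.ofAdd hb)
    · rintro c ⟨hc, hce⟩
      obtain ⟨c, rfl⟩ := exists_eq_incl hf hc
      rw [← map_zpow] at hce
      have := incl_injective hf hce
      exact congrArg (incl hf) (congrArg Multiplicative.ofAdd
        (hbu c.toAdd (congrArg Multiplicative.toAdd this)))

/-- Splittings over `G` of the extension attached to `f` correspond to cochains on `G` whose
coboundary is the pullback of `f`. -/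
def sectionOfCochain {G : Type*} [Group G] (φ : G →* H) (h : G → A)
    (hh : ∀ x y, f (φ x) (φ y) = h x + h y - h (x * y)) : G →* CocycleExtension hf :=
  MonoidHom.mk' (fun x => ⟨-h x, φ x⟩) fun x y => by
    ext
    · simp [hh]
      abel
    · simp

lemma coboundary_of_section {t : H →* CocycleExtension hf}
    (ht : (proj hf).comp t = MonoidHom.id H) (x y : H) :
    f x y = -(t x).fst + -(t y).fst - -(t (x * y)).fst := by
  have hsnd (z : H) : (t z).snd = z := DFunLike.congr_fun ht z
  have := congrArg fst (map_mul t x y)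
  rw [mul_fst, hsnd, hsnd] at this
  rw [this]
  abel

end CocycleExtension

end CocycleExtension

/-- The cohomological form of unique lifting: restriction along `φ` is bijective on `H¹` and
injective on `H²` with coefficients in any `R`-module, phrased on the level of cochains. -/
lemma HasUniqueCentralLifts.existsUnique_cochain {R : Subring ℚ} {G H : Type u} [Group G] [Group H]
    {φ : G →* H} (hφ : HasUniqueCentralLifts R φ) {A : Type u} [AddCommGroup A]
    [Module (ULift.{u} R) A] {f : H → H → A} (hf : IsTrivialCocycle f) (h : G → A)
    (hh : ∀ x y, f (φ x) (φ y) = h x + h y - h (x * y)) :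
    ∃! g : H → A, (∀ x y, f x y = g x + g y - g (x * y)) ∧ ∀ x, g (φ x) = h x := by
  open CocycleExtension in
  obtain ⟨t, ⟨ht, hts⟩, htu⟩ := hφ _ (proj hf) (isCentralExtension_proj hf)
    (sectionOfCochain hf φ h hh) rfl
  refine ⟨fun x => -(t x).fst, ⟨coboundary_of_section hf ht, fun x => ?_⟩, ?_⟩
  · have := congrArg fst (DFunLike.congr_fun hts x)
    exact neg_eq_iff_eq_neg.2 this
  · rintro g ⟨hg, hgφ⟩
    have := htu (sectionOfCochain hf (MonoidHom.id H) g hg) ⟨rfl, by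
      ext x
      · exact congrArg Neg.neg (hgφ x)
      · rfl⟩
    funext x
    rw [← this]
    exact (neg_neg _).symm

section

variable {R : Subring ℚ} {G H : Type u} [Group G] [Group H]

open Finsupp

lemma mapDomain_sub' {k : Type*} [CommRing k] {α β : Type*} (f : α → β) (u v : α →₀ k) :
    mapDomain f (u - v) = mapDomain f u - mapDomain f v :=
  map_sub (lmapDomain k k f) u v

lemma barBoundary₃_mapDomain {k : Type u} [CommRing k] (f : G →* H) (z : G × G × G →₀ k) :
    barBoundary₃ k H (mapDomain (Prod.map f (Prod.map f f)) z) =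
      mapDomain (Prod.map f f) (barBoundary₃ k G z) := by
  induction z using induction_linear with
  | zero => simp
  | add a b ha hb => simp only [mapDomain_add, map_add, ha, hb]
  | single x a =>
    obtain ⟨x, y, w⟩ := x
    simp [mapDomain_single, mapDomain_add, mapDomain_sub']

/-- If two linear maps agree on the boundary of each basis element, they agree on all boundaries. -/
lemma linearMap_barBoundary₂ {k : Type u} [CommRing k] {A : Type*} [AddCommGroup A] [Module k A]
    (F : (G × G →₀ k) →ₗ[k] A) (g : G → A)
    (hg : ∀ x y, F (single (x, y) 1) = g x + g y - g (x * y)) (z : G × G →₀ k) :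
    F z = linearCombination k g (barBoundary₂ k G z) := by
  suffices F = (linearCombination k g).comp (barBoundary₂ k G) from DFunLike.congr_fun this z
  ext ⟨x, y⟩
  simp only [LinearMap.comp_apply, lsingle_apply, barBoundary₂_single, map_add, map_sub,
    linearCombination_single, one_smul, hg]
  abel

/-- Unique lifting is applied to two modules. The cokernel of `C₃(H) ⊕ C₂(G) → C₂(H) ⊕ C₁(G)` in the
mapping cone of `φ` on bar complexes carries a universal 2-cocycle on `H` with a trivialization over
`G`; that the trivialization extends to `H` gives injectivity on `H₁` and surjectivity on `H₂`.
Surjectivity on `H₁` is uniqueness of the extension for the cokernel of `C₂(H) ⊕ C₁(G) → C₁(H)`. -/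
theorem HasUniqueCentralLifts.isTwoConnected {φ : G →* H} (hφ : HasUniqueCentralLifts R φ) :
    IsTwoConnected R φ := by
  let k := ULift.{u} R
  let T : Submodule k ((H × H →₀ k) × (G →₀ k)) :=
    LinearMap.range ((LinearMap.inl k _ _).comp (barBoundary₃ k H)) ⊔
      LinearMap.range ((lmapDomain k k (Prod.map φ φ)).prod (-barBoundary₂ k G))
  let F : (H × H →₀ k) →ₗ[k] (_ ⧸ T) := T.mkQ.comp (LinearMap.inl k _ _)
  let h : (G →₀ k) →ₗ[k] (_ ⧸ T) := T.mkQ.comp (LinearMap.inr k _ _)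
  have hF3 (y : H × H × H →₀ k) : F (barBoundary₃ k H y) = 0 :=
    (Submodule.Quotient.mk_eq_zero T).2 (Submodule.mem_sup_left ⟨y, rfl⟩)
  have hFh (z : G × G →₀ k) : F (mapDomain (Prod.map φ φ) z) = h (barBoundary₂ k G z) := by
    rw [← sub_eq_zero]
    refine (Submodule.Quotient.mk_eq_zero T).2 (Submodule.mem_sup_right ⟨z, ?_⟩)
    ext1 <;> simp
  have hcoc : IsTrivialCocycle fun x y : H => F (single (x, y) 1) := fun x y z => by
    have := hF3 (single (x, y, z) 1)
    simp only [barBoundary₃_single, map_sub, map_add] at this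
    rw [← sub_eq_zero, ← neg_eq_zero, ← this]
    abel
  obtain ⟨g, ⟨hg, hgφ⟩, -⟩ := hφ.existsUnique_cochain hcoc (fun x => h (single x 1)) fun x y => by
    have := hFh (single (x, y) 1)
    simp only [mapDomain_single, Prod.map_apply, barBoundary₂_single, map_sub, map_add] at this
    rw [this]
    abel
  have hFg := linearMap_barBoundary₂ F g hg
  have hgh (c : G →₀ k) : linearCombination k g (mapDomain φ c) = h c := by
    rw [linearCombination_mapDomain]
    suffices linearCombination k (g ∘ φ) = h from DFunLike.congr_fun this c
    ext x
    simp [hgφ]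
  have hT {z : H × H →₀ k} {c : G →₀ k} (hzc : F z + h c = 0) :
      ∃ (y : H × H × H →₀ k) (b : G × G →₀ k),
        z = barBoundary₃ k H y + mapDomain (Prod.map φ φ) b ∧ c = -barBoundary₂ k G b := by
    have hm : (z, (0 : G →₀ k)) + (0, c) ∈ T := by
      rw [← Submodule.Quotient.mk_eq_zero T, Submodule.Quotient.mk_add]
      exact hzc
    obtain ⟨_, ⟨y, rfl⟩, _, ⟨b, rfl⟩, hyb⟩ := Submodule.mem_sup.1 hm
    refine ⟨y, b, ?_, ?_⟩
    · simpa using (congrArg Prod.fst hyb).symm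
    · simpa using (congrArg Prod.snd hyb).symm
  refine ⟨⟨(groupHomologyMap_one_injective_iff φ).2 fun c z hcz => ?_,
    (groupHomologyMap_one_surjective_iff φ).2 ?_⟩,
    (groupHomologyMap_two_surjective_iff φ).2 fun z hz => ?_⟩
  · obtain ⟨y, b, -, hb⟩ := hT (z := -z) (c := c) (by
      rw [map_neg, hFg, ← hcz, hgh, neg_add_cancel])
    exact ⟨-b, by rw [hb, map_neg]⟩
  · let U : Submodule k (H →₀ k) :=
      LinearMap.range (barBoundary₂ k H) ⊔ LinearMap.range (lmapDomain k k φ)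
    have h0 : IsTrivialCocycle fun _ _ : H => (0 : (H →₀ k) ⧸ U) := fun _ _ _ => rfl
    obtain ⟨g', -, hg'⟩ := hφ.existsUnique_cochain h0 (fun _ => 0) (by simp)
    have hz := hg' (fun _ => 0) (by simp)
    have hm := hg' (fun x => U.mkQ (single x 1)) ⟨fun x y => by
      rw [← map_add, ← map_sub]
      refine ((Submodule.Quotient.mk_eq_zero U).2
        (Submodule.mem_sup_left ⟨single (x, y) 1, ?_⟩)).symm
      rw [barBoundary₂_single]
      abel, fun x => (Submodule.Quotient.mk_eq_zero U).2
        (Submodule.mem_sup_right ⟨single x 1, by simp [mapDomain_single]⟩)⟩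
    have hU : U.mkQ = 0 := by
      ext x
      simpa using congrFun (hm.trans hz.symm) x
    intro c
    have hc := (Submodule.Quotient.mk_eq_zero U).1 (DFunLike.congr_fun hU c)
    obtain ⟨_, ⟨z, rfl⟩, _, ⟨b, rfl⟩, hzb⟩ := Submodule.mem_sup.1 hc
    exact ⟨b, z, by rw [← hzb, add_comm]; rfl⟩
  · obtain ⟨y, b, hb, hb'⟩ := hT (z := z) (c := 0) (by
      rw [hFg, hz, map_zero, map_zero, add_zero])
    exact ⟨b, y, neg_eq_zero.1 hb'.symm, by rw [hb, add_comm]⟩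

/-- For a surjection that is 2-connected, a 1-chain in the kernel is the boundary of a 2-chain
in the kernel. -/
lemma IsTwoConnected.exists_barBoundary₂_eq {q : G →* H} (hq : IsTwoConnected R q)
    (hs : Function.Surjective q) (c : G →₀ ULift.{u} R) (hc : mapDomain q c = 0) :
    ∃ z, mapDomain (Prod.map q q) z = 0 ∧ c = barBoundary₂ _ G z := by
  have hs3 : Function.Surjective (Prod.map q (Prod.map q q)) := hs.prodMap (hs.prodMap hs)
  obtain ⟨z, rfl⟩ := (groupHomologyMap_one_injective_iff q).1 hq.1.1 c 0 (by rw [hc, map_zero])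
  obtain ⟨b, y, hb, hby⟩ := (groupHomologyMap_two_surjective_iff q).1 hq.2
    (mapDomain (Prod.map q q) z) (by rw [barBoundary₂_mapDomain, hc])
  obtain ⟨y, rfl⟩ := mapDomain_surjective hs3 y
  have h3 := barBoundary₃_mapDomain q y
  have h23 : barBoundary₂ _ G (barBoundary₃ (ULift.{u} R) G y) = 0 := by
    rw [← groupHomology_d₂₁_trivial, ← groupHomology_d₃₂_trivial]
    exact DFunLike.congr_fun (congrArg ModuleCat.Hom.hom (groupHomology.d₃₂_comp_d₂₁
      (Rep.trivial (ULift.{u} R) G (ULift.{u} R)))) y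
  refine ⟨z - b - barBoundary₃ _ G y, ?_, ?_⟩
  · rw [mapDomain_sub', mapDomain_sub', hby, ← h3]
    abel
  · simp [hb, h23]

end

/-! ### Systems of equations -/

lemma FreeGroup.map_lift_apply {α G H : Type*} [Group G] [Group H] (φ : G →* H) (f : α → G)
    (w : FreeGroup α) : φ (FreeGroup.lift f w) = FreeGroup.lift (φ ∘ f) w := by
  suffices φ.comp (FreeGroup.lift f) = FreeGroup.lift (φ ∘ f) from DFunLike.congr_fun this w
  ext
  simp

/-- The shape of a finite `R`-nullhomologous system of equations `x_j ^ e_j = w_j(p, x)` in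
variables `x_j`, where `e_j` is invertible in `R` and `w_j` is a word in the variables and in
parameters `p_i`. Every variable occurs in `w_j` with total exponent zero. The parameters stand
for the coefficients in a group, so that the shapes form a countable type. -/
structure SystemShape (R : Subring ℚ) where
  /-- The number of parameters. -/
  m : ℕ
  /-- The number of variables, and of equations. -/
  n : ℕ
  /-- The exponents on the left-hand sides. -/
  exp : Fin n → ℤ
  /-- The right-hand sides. -/
  word : Fin n → FreeGroup (Fin m ⊕ Fin n)
  exp_mem : ∀ j, exp j ∈ invertibleIntegers R
  word_null : ∀ j, FreeGroup.lift
    (Sum.elim (fun _ => 1) fun i => Abelianization.of (FreeGroup.of i)) (word j) =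
      (1 : Abelianization (FreeGroup (Fin n)))

namespace SystemShape

variable {R : Subring ℚ} (S : SystemShape R)

/-- `x` solves the system of shape `S` with coefficients `p`. -/
def IsSolution {G : Type*} [Group G] (p : Fin S.m → G) (x : Fin S.n → G) : Prop :=
  ∀ j, x j ^ S.exp j = FreeGroup.lift (Sum.elim p x) (S.word j)

variable {S}

lemma IsSolution.map {G H : Type*} [Group G] [Group H] {p : Fin S.m → G} {x : Fin S.n → G}
    (h : S.IsSolution p x) (φ : G →* H) : S.IsSolution (φ ∘ p) (φ ∘ x) := fun j => by
  rw [← Sum.comp_elim, ← FreeGroup.map_lift_apply, ← h j, map_zpow]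
  rfl

open scoped IsMulCommutative in
/-- Multiplying the variables by central elements does not change the right-hand sides. -/
lemma lift_word_mul_central {E : Type*} [Group E] (p : Fin S.m → E) (x a : Fin S.n → E)
    (ha : ∀ i, a i ∈ Subgroup.center E) (j : Fin S.n) :
    FreeGroup.lift (Sum.elim p (x * a)) (S.word j) = FreeGroup.lift (Sum.elim p x) (S.word j) := by
  let L : FreeGroup (Fin S.m ⊕ Fin S.n) →* Subgroup.center E :=
    FreeGroup.lift (Sum.elim (fun _ => 1) fun i => ⟨a i, ha i⟩)
  have hL : L (S.word j) = 1 := by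
    have : L = (Abelianization.lift
          (FreeGroup.lift fun i => (⟨a i, ha i⟩ : Subgroup.center E))).comp
        (FreeGroup.lift (Sum.elim (fun _ => 1) fun i => Abelianization.of (FreeGroup.of i))) := by
      ext (i | i) <;> simp [L]
    rw [this, MonoidHom.comp_apply, S.word_null, map_one]
  let F : FreeGroup (Fin S.m ⊕ Fin S.n) →* E :=
    MonoidHom.mk' (fun w => FreeGroup.lift (Sum.elim p x) w * (L w : E)) fun v w => by
      rw [map_mul, map_mul, Subgroup.coe_mul, mul_assoc, mul_assoc]
      congr 1
      rw [← mul_assoc, ← mul_assoc, Subgroup.mem_center_iff.1 (L v).2]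
  have hF : FreeGroup.lift (Sum.elim p (x * a)) = F := by
    ext (i | i) <;> simp [F, L]
  rw [hF]
  change _ * (L (S.word j) : E) = _
  rw [hL, Subgroup.coe_one, mul_one]

/-- Solutions lift uniquely along central extensions by `R`-modules: changing the variables by
elements of the kernel changes the left-hand sides bijectively and leaves the right-hand sides
alone. -/
lemma existsUnique_isSolution_lift {E H : Type*} [Group E] [Group H] {q : E →* H}
    (hq : IsCentralExtension R q) (p : Fin S.m → E) (y : Fin S.n → H)
    (hy : S.IsSolution (q ∘ p) y) : ∃! x, S.IsSolution p x ∧ q ∘ x = y := by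
  have hc {a : E} (ha : q a = 1) : a ∈ Subgroup.center E :=
    Subgroup.mem_center_iff.2 fun b => (hq.central a ha b).symm
  choose x₀ hx₀ using fun i => hq.surjective (y i)
  obtain rfl : q ∘ x₀ = y := funext hx₀
  let d (j : Fin S.n) : E := (x₀ j ^ S.exp j)⁻¹ * FreeGroup.lift (Sum.elim p x₀) (S.word j)
  have hd (j : Fin S.n) : q (d j) = 1 := by
    rw [map_mul, map_inv, FreeGroup.map_lift_apply, Sum.comp_elim, ← hy j, map_zpow]
    exact inv_mul_cancel _
  have key (a : Fin S.n → E) (ha : ∀ i, q (a i) = 1) :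
      S.IsSolution p (x₀ * a) ↔ ∀ j, a j ^ S.exp j = d j := by
    refine forall_congr' fun j => ?_
    have hcomm : Commute (x₀ j) (a j) := Subgroup.mem_center_iff.1 (hc (ha j)) _
    rw [lift_word_mul_central p x₀ a (fun i => hc (ha i)), Pi.mul_apply, hcomm.mul_zpow,
      eq_inv_mul_iff_mul_eq]
  choose a ha hau using fun j => hq.divisible (S.exp j) (S.exp_mem j) (d j) (hd j)
  refine ⟨x₀ * a, ⟨(key a fun i => (ha i).1).2 fun j => (ha j).2, ?_⟩, ?_⟩
  · ext i
    simp [(ha i).1]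
  · rintro x ⟨hx, hqx⟩
    have hb (i : Fin S.n) : q ((x₀⁻¹ * x) i) = 1 := by
      have := congrFun hqx i
      simp only [Function.comp_apply] at this
      simp [this]
    have hx' : x = x₀ * (x₀⁻¹ * x) := by simp
    rw [hx'] at hx
    have := (key _ hb).1 hx
    rw [hx']
    congr 1
    exact funext fun j => hau j _ ⟨hb j, this j⟩

/-! ### Adjoining and identifying solutions -/

section Adjoin

variable (S) {G : Type u} [Group G]

/-- The defining relators of the group obtained from `G` by adjoining a solution. -/
def relator (p : Fin S.m → G) (j : Fin S.n) : Monoid.Coprod G (FreeGroup (Fin S.n)) :=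
  Monoid.Coprod.inr (FreeGroup.of j) ^ S.exp j *
    (FreeGroup.lift (Sum.elim (Monoid.Coprod.inl ∘ p) (Monoid.Coprod.inr ∘ FreeGroup.of))
      (S.word j))⁻¹

/-- The group obtained from `G` by freely adjoining a solution of a system. -/
abbrev Adjoin (p : Fin S.m → G) : Type u :=
  Monoid.Coprod G (FreeGroup (Fin S.n)) ⧸ Subgroup.normalClosure (Set.range (S.relator p))

variable (p : Fin S.m → G)

/-- The canonical map to the group with an adjoined solution. -/
def toAdjoin : G →* S.Adjoin p := (QuotientGroup.mk' _).comp Monoid.Coprod.inl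

/-- The adjoined solution. -/
def root (j : Fin S.n) : S.Adjoin p := QuotientGroup.mk' _ (Monoid.Coprod.inr (FreeGroup.of j))

lemma isSolution_root : S.IsSolution (S.toAdjoin p ∘ p) (S.root p) := fun j => by
  have h : QuotientGroup.mk' (Subgroup.normalClosure (Set.range (S.relator p)))
      (S.relator p j) = 1 :=
    (QuotientGroup.eq_one_iff _).2 (Subgroup.subset_normalClosure ⟨j, rfl⟩)
  rw [relator, map_mul, map_inv, mul_inv_eq_one, FreeGroup.map_lift_apply, map_zpow,
    Sum.comp_elim] at h
  exact h

variable {S p}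

lemma Adjoin.hom_ext {E : Type*} [Group E] {f g : S.Adjoin p →* E}
    (h : f.comp (S.toAdjoin p) = g.comp (S.toAdjoin p)) (h' : f ∘ S.root p = g ∘ S.root p) :
    f = g := by
  refine QuotientGroup.monoidHom_ext _ (Monoid.Coprod.hom_ext h ?_)
  ext j
  exact congrFun h' j

lemma Adjoin.exists_lift {E : Type*} [Group E] (f : G →* E) {x : Fin S.n → E}
    (hx : S.IsSolution (f ∘ p) x) :
    ∃ g : S.Adjoin p →* E, g.comp (S.toAdjoin p) = f ∧ g ∘ S.root p = x := by
  refine ⟨QuotientGroup.lift _ (Monoid.Coprod.lift f (FreeGroup.lift x)) ?_, ?_, ?_⟩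
  · refine Subgroup.normalClosure_le_normal (N := MonoidHom.ker _) ?_
    rintro _ ⟨j, rfl⟩
    rw [SetLike.mem_coe, MonoidHom.mem_ker, relator, map_mul, map_inv, mul_inv_eq_one,
      FreeGroup.map_lift_apply, map_zpow, Sum.comp_elim]
    have h1 : Monoid.Coprod.lift f (FreeGroup.lift x) ∘ Monoid.Coprod.inl ∘ p = f ∘ p := by
      ext; simp
    have h2 : Monoid.Coprod.lift f (FreeGroup.lift x) ∘ Monoid.Coprod.inr ∘ FreeGroup.of = x := by
      ext; simp
    rw [h1, h2, ← hx j]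
    simp
  · ext g
    simp [toAdjoin]
  · ext j
    simp [root]

lemma isTwoConnected_toAdjoin : IsTwoConnected R (S.toAdjoin p) := by
  refine HasUniqueCentralLifts.isTwoConnected fun E _ q hq s hs => ?_
  obtain ⟨x, ⟨hx, hqx⟩, hxu⟩ := existsUnique_isSolution_lift hq (s ∘ p) (S.root p) (by
    have := S.isSolution_root p
    rw [← hs] at this
    exact this)
  obtain ⟨t, hts, htx⟩ := Adjoin.exists_lift s hx
  refine ⟨t, ⟨Adjoin.hom_ext ?_ ?_, hts⟩, ?_⟩
  · rw [MonoidHom.comp_assoc, hts, hs, MonoidHom.id_comp]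
  · rw [MonoidHom.coe_comp, Function.comp_assoc, htx, hqx]
    rfl
  · rintro t' ⟨ht', hts'⟩
    refine Adjoin.hom_ext (hts'.trans hts.symm) (((hxu _ ⟨?_, ?_⟩)).trans htx.symm)
    · have := (S.isSolution_root p).map t'
      rwa [← Function.comp_assoc, ← MonoidHom.coe_comp, hts'] at this
    · rw [← Function.comp_assoc, ← MonoidHom.coe_comp, ht']
      rfl

instance [Group.IsFinitelyPresented G] : Group.IsFinitelyPresented (S.Adjoin p) :=
  Group.IsFinitelyPresented.quotient _ ⟨_, Set.finite_range _, rfl⟩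

lemma Adjoin.group_fg (hG : Group.FG G) : Group.FG (S.Adjoin p) := by
  have : Group.FG (Monoid.Coprod G (FreeGroup (Fin S.n))) := by
    rw [Group.fg_def, ← Monoid.Coprod.range_inl_sup_range_inr]
    exact ((Group.fg_iff_subgroup_fg _).1 inferInstance).sup
      ((Group.fg_iff_subgroup_fg _).1 inferInstance)
  infer_instance

end Adjoin

section Identify

variable {G : Type u} [Group G]

/-- The quotient of `G` that identifies two tuples of elements. -/
abbrev Identify {n : ℕ} (x y : Fin n → G) : Type u :=
  G ⧸ Subgroup.normalClosure (Set.range fun j => x j * (y j)⁻¹)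

lemma Identify.comp_eq {n : ℕ} (x y : Fin n → G) :
    (QuotientGroup.mk' _ : G →* Identify x y) ∘ x = QuotientGroup.mk' _ ∘ y := by
  ext j
  have h : QuotientGroup.mk' (Subgroup.normalClosure (Set.range fun j => x j * (y j)⁻¹))
      (x j * (y j)⁻¹) = 1 :=
    (QuotientGroup.eq_one_iff _).2 (Subgroup.subset_normalClosure ⟨j, rfl⟩)
  rwa [map_mul, map_inv, mul_inv_eq_one] at h

lemma isTwoConnected_identify {p : Fin S.m → G} {x y : Fin S.n → G} (hx : S.IsSolution p x)
    (hy : S.IsSolution p y) :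
    IsTwoConnected R (QuotientGroup.mk' _ : G →* Identify x y) := by
  refine HasUniqueCentralLifts.isTwoConnected fun E _ q hq s hs => ?_
  have hxy : s ∘ x = s ∘ y := by
    refine (existsUnique_isSolution_lift hq (s ∘ p) (q ∘ (s ∘ x)) ((hx.map s).map q)).unique
      ⟨hx.map s, rfl⟩ ⟨hy.map s, ?_⟩
    rw [← Function.comp_assoc, ← Function.comp_assoc, ← MonoidHom.coe_comp, hs, Identify.comp_eq]
  have hker : Subgroup.normalClosure (Set.range fun j => x j * (y j)⁻¹) ≤ s.ker := by
    refine Subgroup.normalClosure_le_normal ?_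
    rintro _ ⟨j, rfl⟩
    rw [SetLike.mem_coe, MonoidHom.mem_ker, map_mul, map_inv, mul_inv_eq_one]
    exact congrFun hxy j
  refine ⟨QuotientGroup.lift _ s hker, ⟨?_, ?_⟩, ?_⟩
  · exact QuotientGroup.monoidHom_ext _ hs
  · ext; rfl
  · rintro t ⟨-, ht⟩
    exact QuotientGroup.monoidHom_ext _ (by rw [ht]; ext; rfl)

end Identify

end SystemShape

/-- Every finite system over a finitely presented group acquires a solution in a finitely presented
2-connected extension, which can be chosen to identify any two given solutions. -/
lemma exists_omegaR_solve {R : Subring ℚ} (S : SystemShape R) {G : Type u} [Group G]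
    (hG : Group.IsFinitelyPresented G) (p : Fin S.m → G) (x y : Fin S.n → G) :
    ∃ (H : Type u) (_ : Group H) (φ : G →* H), Group.IsFinitelyPresented H ∧
      IsTwoConnected R φ ∧ (∃ z, S.IsSolution (φ ∘ p) z) ∧
      (S.IsSolution p x → S.IsSolution p y → φ ∘ x = φ ∘ y) := by
  by_cases h : S.IsSolution p x ∧ S.IsSolution p y
  · refine ⟨SystemShape.Identify x y, inferInstance, QuotientGroup.mk' _,
      Group.IsFinitelyPresented.quotient _ ⟨_, Set.finite_range _, rfl⟩,
      SystemShape.isTwoConnected_identify h.1 h.2, ⟨_, h.1.map _⟩, fun _ _ =>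
      SystemShape.Identify.comp_eq x y⟩
  · exact ⟨S.Adjoin p, inferInstance, S.toAdjoin p, inferInstance,
      SystemShape.isTwoConnected_toAdjoin, ⟨_, S.isSolution_root p⟩, fun hx hy => (h ⟨hx, hy⟩).elim⟩

instance (R : Subring ℚ) : Countable (SystemShape R) := by
  let F : SystemShape R → Σ m n : ℕ, (Fin n → ℤ) × (Fin n → FreeGroup (Fin m ⊕ Fin n)) :=
    fun S => ⟨S.m, S.n, S.exp, S.word⟩
  have (m n : ℕ) : Countable (FreeGroup (Fin m ⊕ Fin n)) := Quot.mk_surjective.countable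
  refine Function.Injective.countable (f := F) fun S T h => ?_
  obtain ⟨m, n, e, w, _, _⟩ := S
  obtain ⟨m', n', e', w', _, _⟩ := T
  simp only [F, Sigma.mk.injEq] at h
  obtain ⟨rfl, h⟩ := h
  have h := eq_of_heq h
  simp only [Sigma.mk.injEq] at h
  obtain ⟨rfl, h⟩ := h
  have h := eq_of_heq h
  simp only [Prod.mk.injEq] at h
  obtain ⟨rfl, rfl⟩ := h
  rfl

lemma Group.IsFinitelyPresented.countable {G : Type*} [Group G] (hG : Group.IsFinitelyPresented G) :
    Countable G := by
  obtain ⟨n, φ, hφ, -⟩ := hG.out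
  have : Countable (FreeGroup (Fin n)) := Quot.mk_surjective.countable
  exact hφ.countable

lemma Group.IsFinitelyPresented.fg {G : Type*} [Group G] (hG : Group.IsFinitelyPresented G) :
    Group.FG G := by
  obtain ⟨n, φ, hφ, -⟩ := hG.out
  exact Group.fg_of_surjective hφ

/-! ### Divisibility extracted from 2-connectedness -/

section Localization

variable (R : Subring ℚ)

instance : IsLocalization (invertibleIntegers R) (ULift.{u} R) where
  map_units e := by
    simpa using (mem_invertibleIntegers.1 e.2).map (ULift.ringEquiv (R := R)).symm
  surj z := by
    -- by Bézout, a fraction in lowest terms lies in `R` only if the inverse of its denominator does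
    obtain ⟨⟨z, hz⟩⟩ := z
    have hden : (z.den : ℚ) ≠ 0 := by exact_mod_cast z.den_nz
    have hcop : IsCoprime z.num (z.den : ℤ) := by
      rw [Int.isCoprime_iff_gcd_eq_one]; exact z.reduced
    obtain ⟨a, b, hab⟩ := hcop
    have hinv : (z.den : ℚ)⁻¹ ∈ R := by
      have : (z.den : ℚ)⁻¹ = a * z + b := by
        have h1 : (a : ℚ) * z.num + b * z.den = 1 := by exact_mod_cast hab
        have h2 : z * z.den = z.num := Rat.mul_den_eq_num z
        field_simp
        rw [← h1, ← h2]
        ring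
      rw [this]
      exact add_mem (mul_mem (intCast_mem R a) hz) (intCast_mem R b)
    refine ⟨(z.num, ⟨z.den, mem_invertibleIntegers.2 ?_⟩), ?_⟩
    · refine IsUnit.of_mul_eq_one ⟨_, hinv⟩ (Subtype.ext ?_)
      simp [hden]
    · refine ULift.ext _ _ (Subtype.ext ?_)
      simp
  exists_of_eq {x y} h := by
    refine ⟨1, ?_⟩
    have := congrArg (fun t : ULift R => ((t.down : R) : ℚ)) h
    have : (x : ℚ) = y := by simpa using this
    simpa using this

/-- Every abelian group maps to an `R`-module, with kernel the torsion that is invertible in `R`. -/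
lemma exists_hom_module_of_invertibleIntegers (A : Type u) [AddCommGroup A] :
    ∃ (B : Type u) (_ : AddCommGroup B) (_ : Module (ULift.{u} R) B) (f : A →+ B),
      ∀ a, f a = 0 → ∃ e ∈ invertibleIntegers R, e • a = 0 := by
  refine ⟨LocalizedModule (invertibleIntegers R) A, inferInstance,
    LocalizedModule.moduleOfIsLocalization (S := invertibleIntegers R) (T := ULift.{u} R),
    (LocalizedModule.mkLinearMap (invertibleIntegers R) A).toAddMonoidHom, fun a ha => ?_⟩
  obtain ⟨e, he⟩ := LocalizedModule.mk_eq.1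
    ((show LocalizedModule.mk a 1 = 0 from ha).trans (LocalizedModule.zero_mk 1).symm)
  exact ⟨e, e.2, by simpa [Submonoid.smul_def] using he⟩

end Localization

section Divisibility

variable {R : Subring ℚ} {G H : Type u} [Group G] [Group H]

open Finsupp

/-- Surjectivity on first homology, on the level of elements. -/
lemma IsTwoConnected.exists_zpow_eq {φ : G →* H} (hφ : IsTwoConnected R φ) (y : H) :
    ∃ e ∈ invertibleIntegers R, ∃ a : G, ∃ c ∈ commutator H, y ^ e = φ a * c := by
  let M := Abelianization H ⧸ (Abelianization.map φ).range
  obtain ⟨B, _, _, f, hf⟩ := exists_hom_module_of_invertibleIntegers R (Additive M)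
  let m : H →* M := (QuotientGroup.mk' _).comp Abelianization.of
  let L : (H →₀ ULift.{u} R) →ₗ[ULift.{u} R] B :=
    linearCombination _ fun y => f (Additive.ofMul (m y))
  have hm (a : G) : m (φ a) = 1 :=
    (QuotientGroup.eq_one_iff _).2 ⟨Abelianization.of a, by simp⟩
  have hL : L (single y 1) = 0 := by
    obtain ⟨b, z, hbz⟩ := (groupHomologyMap_one_surjective_iff φ).1 hφ.1.2 (single y 1)
    have h1 : L (mapDomain φ b) = 0 := by
      simp only [L, linearCombination_mapDomain]
      have : (fun y => f (Additive.ofMul (m y))) ∘ φ = 0 := by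
        funext a
        simp [hm]
      rw [this, linearCombination_zero, LinearMap.zero_apply]
    have h2 : L (barBoundary₂ _ H z) = 0 := by
      rw [← linearMap_barBoundary₂ 0 (fun y => f (Additive.ofMul (m y))) (fun x y => by
        simp [map_mul]) z, LinearMap.zero_apply]
    rw [hbz, map_add, h1, h2, add_zero]
  obtain ⟨e, he, hey⟩ := hf (Additive.ofMul (m y)) (by simpa [L] using hL)
  have hey' : m (y ^ e) = 1 := by
    rw [map_zpow]
    exact congrArg Additive.toMul hey
  obtain ⟨a, ha⟩ := (QuotientGroup.eq_one_iff _).1 hey'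
  obtain ⟨a, rfl⟩ := QuotientGroup.mk'_surjective _ a
  refine ⟨e, he, a, (φ a)⁻¹ * y ^ e, ?_, by simp⟩
  rw [← Abelianization.ker_of, MonoidHom.mem_ker, map_mul, map_inv, ← ha]
  exact inv_mul_cancel _

open scoped IsMulCommutative in
/-- For a 2-connected surjection with kernel `K`, Stallings' exact sequence shows that
`K / [K, G]` is torsion of order invertible in `R`. For a set-theoretic section `s` of `q`, the
class of `x * (s (q x))⁻¹` in `K / [K, G]`, mapped to an `R`-module, is a 1-cochain on `G` whose
coboundary is pulled back from `H`. Hence it vanishes on boundaries of 2-chains in the kernel of `q`, and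
`x - 1` is such a boundary for every `x` in `K`. -/
lemma IsTwoConnected.exists_zpow_mem_commutator {q : G →* H} (hq : IsTwoConnected R q)
    (hs : Function.Surjective q) {x : G} (hx : q x = 1) :
    ∃ e ∈ invertibleIntegers R, x ^ e ∈ ⁅q.ker, (⊤ : Subgroup G)⁆ := by
  let N := ⁅q.ker, (⊤ : Subgroup G)⁆
  let m : G →* G ⧸ N := QuotientGroup.mk' N
  have hcen (a : q.ker) : m a ∈ Subgroup.center (G ⧸ N) := by
    rw [Subgroup.mem_center_iff]
    intro b
    obtain ⟨b, rfl⟩ := QuotientGroup.mk'_surjective N b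
    have : m ((a : G) * b * (a : G)⁻¹ * b⁻¹) = 1 := (QuotientGroup.eq_one_iff _).2
      (Subgroup.commutator_mem_commutator a.2 (Subgroup.mem_top b))
    rw [map_mul, map_mul, map_mul, map_inv, map_inv, mul_inv_eq_one, mul_inv_eq_iff_eq_mul] at this
    exact this.symm
  let κ : q.ker →* Subgroup.center (G ⧸ N) := (m.comp q.ker.subtype).codRestrict _ hcen
  obtain ⟨B, _, _, f, hf⟩ :=
    exists_hom_module_of_invertibleIntegers R (Additive (Subgroup.center (G ⧸ N)))
  obtain ⟨s, hsec⟩ := hs.hasRightInverse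
  let d (x : G) : q.ker := ⟨x * (s (q x))⁻¹, by simp [MonoidHom.mem_ker, hsec (q x)]⟩
  let c (u v : H) : q.ker := ⟨s u * s v * (s (u * v))⁻¹, by simp [MonoidHom.mem_ker, hsec _]⟩
  let h (x : G) : B := f (Additive.ofMul (κ (d x)))
  have hdc (x y : G) : κ (d x) * κ (d y) * κ (c (q x) (q y)) = κ (d (x * y)) := by
    refine Subtype.ext ?_
    have hD : (m (s (q x)))⁻¹ * m (y * (s (q y))⁻¹) = m (y * (s (q y))⁻¹) * (m (s (q x)))⁻¹ :=
      Subgroup.mem_center_iff.1 (hcen (d y)) (m (s (q x)))⁻¹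
    change m (x * (s (q x))⁻¹) * m (y * (s (q y))⁻¹) *
      m (s (q x) * s (q y) * (s (q x * q y))⁻¹) = m (x * y * (s (q (x * y)))⁻¹)
    simp only [map_mul, map_inv] at hD ⊢
    rw [mul_assoc (m x), hD]
    group
  have hh (x y : G) : -f (Additive.ofMul (κ (c (q x) (q y)))) = h x + h y - h (x * y) := by
    simp only [h, ← hdc x y, ofMul_mul, map_add]
    abel
  let k := ULift.{u} R
  let C : (H × H →₀ k) →ₗ[k] B :=
    linearCombination k fun u => -f (Additive.ofMul (κ (c u.1 u.2)))
  let F : (G × G →₀ k) →ₗ[k] B := C.comp (lmapDomain k k (Prod.map q q))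
  have hF := linearMap_barBoundary₂ F h fun x y => by
    rw [← hh]
    simp [F, C, mapDomain_single]
  obtain ⟨z, hz, hxz⟩ := hq.exists_barBoundary₂_eq hs (single x 1 - single 1 1) (by
    simp [mapDomain_sub', mapDomain_single, hx])
  have hx1 : h x = h 1 := by
    have := hF z
    rw [← hxz] at this
    simp only [F, LinearMap.comp_apply, lmapDomain_apply, hz, map_zero, map_sub,
      linearCombination_single, one_smul] at this
    exact sub_eq_zero.1 this.symm
  have hdx : d x = ⟨x, hx⟩ * d 1 := Subtype.ext (by simp [d, hx])
  have hfx : f (Additive.ofMul (κ ⟨x, hx⟩)) = 0 := by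
    simpa only [h, hdx, map_mul, ofMul_mul, map_add, add_eq_right] using hx1
  obtain ⟨e, he, hex⟩ := hf _ hfx
  refine ⟨e, he, (QuotientGroup.eq_one_iff _).1 ?_⟩
  have := congrArg (fun a => ((Additive.toMul a : Subgroup.center (G ⧸ N)) : G ⧸ N)) hex
  exact this

end Divisibility

/-! ### Kernels of surjections onto finitely presented groups -/

lemma Group.FG.exists_fin_generators {G : Type*} [Group G] (hG : Group.FG G) :
    ∃ (n : ℕ) (x : Fin n → G), Function.Surjective (FreeGroup.lift x) := by
  obtain ⟨S, hS, hfin⟩ := Group.fg_iff.1 hG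
  obtain ⟨n, f, -, rfl⟩ := hfin.fin_param
  refine ⟨n, f, ?_⟩
  rw [← MonoidHom.range_eq_top, FreeGroup.range_lift_eq_closure, hS]

/-- The kernel of a surjection from a finitely generated to a finitely presented group is normally
generated by finitely many elements. -/
lemma Group.IsFinitelyPresented.exists_normalClosure_eq_ker {G H : Type*} [Group G] [Group H]
    (hG : Group.FG G) (hH : Group.IsFinitelyPresented H) {q : G →* H}
    (hq : Function.Surjective q) :
    ∃ (n : ℕ) (x : Fin n → G), Subgroup.normalClosure (Set.range x) = q.ker := by
  obtain ⟨m, y, hy⟩ := hG.exists_fin_generators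
  obtain ⟨n, φ, hφ, T, hT, hTφ⟩ := hH.out
  choose t ht using fun i => hq (φ (FreeGroup.of i))
  have hqt : q.comp (FreeGroup.lift t) = φ := by ext i; simp [ht]
  choose v hv using fun j => hφ (q (y j))
  let U : Set G := FreeGroup.lift t '' T ∪ Set.range fun j => y j * (FreeGroup.lift t (v j))⁻¹
  have hU : U.Finite := (hT.image _).union (Set.finite_range _)
  let N := Subgroup.normalClosure U
  have hN : N = q.ker := by
    have hNker : N ≤ q.ker := by
      refine Subgroup.normalClosure_le_normal ?_
      rintro _ (⟨w, hw, rfl⟩ | ⟨j, rfl⟩)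
      · have : w ∈ φ.ker := hTφ ▸ Subgroup.subset_normalClosure hw
        rwa [← hqt] at this
      · have := DFunLike.congr_fun hqt (v j)
        simp only [MonoidHom.comp_apply] at this
        simp [MonoidHom.mem_ker, this, hv]
    refine le_antisymm hNker fun x hx => ?_
    · let r := QuotientGroup.mk' N
      -- modulo `N`, every element comes from the free group of the presentation
      have hr : ((r.comp (FreeGroup.lift t)).range) = ⊤ := by
        have hry : Function.Surjective (r.comp (FreeGroup.lift y)) :=
          (QuotientGroup.mk'_surjective N).comp hy
        rw [eq_top_iff, ← MonoidHom.range_eq_top.2 hry]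
        rintro _ ⟨w, rfl⟩
        induction w using FreeGroup.induction_on with
        | C1 => simp
        | of j =>
          refine ⟨v j, ?_⟩
          have : r (y j * (FreeGroup.lift t (v j))⁻¹) = 1 := (QuotientGroup.eq_one_iff _).2
            (Subgroup.subset_normalClosure (Or.inr ⟨j, rfl⟩))
          rw [map_mul, map_inv, mul_inv_eq_one] at this
          simpa using this.symm
        | inv_of j hj => simpa using inv_mem hj
        | mul a b ha hb => simpa using mul_mem ha hb
      obtain ⟨w, hw⟩ : r x ∈ (r.comp (FreeGroup.lift t)).range := hr ▸ Subgroup.mem_top _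
      have hxw : x⁻¹ * FreeGroup.lift t w ∈ N := QuotientGroup.eq.1 hw.symm
      have hwN : FreeGroup.lift t w ∈ N := by
        have hwφ : w ∈ φ.ker := by
          have := hNker hxw
          rw [MonoidHom.mem_ker, map_mul, map_inv, MonoidHom.mem_ker.1 hx, inv_one, one_mul] at this
          rwa [← hqt]
        have : φ.ker ≤ N.comap (FreeGroup.lift t) := by
          rw [← hTφ]
          exact Subgroup.normalClosure_le_normal fun w hw =>
            Subgroup.subset_normalClosure (Or.inl ⟨w, hw, rfl⟩)
        exact this hwφ
      have := mul_mem hwN (inv_mem hxw)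
      simpa using this
  obtain ⟨k, x, -, hx⟩ := hU.fin_param
  exact ⟨k, x, by rw [hx]; exact hN⟩

/-! ### Closed groups -/

section Closed

/-- A group is `R`-closed if every finite `R`-nullhomologous system of equations over it has a
unique solution. -/
def IsRClosed (R : Subring ℚ) (A : Type*) [Group A] : Prop :=
  ∀ (S : SystemShape R) (p : Fin S.m → A), ∃! x, S.IsSolution p x

variable {R : Subring ℚ}

lemma MonoidHom.ext_of_freeGroup_lift {ι G H : Type*} [Group G] [Group H] {x : ι → G}
    (hx : Function.Surjective (FreeGroup.lift x)) {f g : G →* H} (h : f ∘ x = g ∘ x) : f = g := by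
  ext y
  obtain ⟨w, rfl⟩ := hx y
  rw [FreeGroup.map_lift_apply, FreeGroup.map_lift_apply, h]

/-- If `φ` is surjective on first homology, finitely many generators of the target solve a system
with coefficients in the source. -/
lemma IsTwoConnected.exists_system {π G : Type u} [Group π] [Group G] {φ : π →* G}
    (hφ : IsTwoConnected R φ) (hπ : Group.FG π) {n : ℕ} (x : Fin n → G)
    (hx : Function.Surjective (FreeGroup.lift x)) :
    ∃ (m : ℕ) (p : Fin m → π) (w : Fin n → FreeGroup (Fin m ⊕ Fin n)) (e : Fin n → ℤ)
      (he : ∀ j, e j ∈ invertibleIntegers R) (hw : _),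
      (SystemShape.mk m n e w he hw).IsSolution (φ ∘ p) x := by
  obtain ⟨m, p, hp⟩ := hπ.exists_fin_generators
  choose e he a c hc hxe using fun j => hφ.exists_zpow_eq (x j)
  choose u hu using fun j => hp (a j)
  have hcomm : commutator G = (commutator (FreeGroup (Fin n))).map (FreeGroup.lift x) := by
    rw [commutator_def, commutator_def, Subgroup.map_commutator,
      Subgroup.map_top_of_surjective _ hx]
  choose v hv hvc using fun j => show c j ∈ (commutator (FreeGroup (Fin n))).map _ from
    hcomm ▸ hc j
  refine ⟨m, p, fun j => FreeGroup.map Sum.inl (u j) * FreeGroup.map Sum.inr (v j), e, he,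
    fun j => ?_, fun j => ?_⟩
  · have h1 : FreeGroup.lift
        (Sum.elim (fun _ : Fin m => 1) fun i => Abelianization.of (FreeGroup.of i))
        (FreeGroup.map Sum.inl (u j)) = (1 : Abelianization (FreeGroup (Fin n))) := by
      rw [FreeGroup.map_eq_lift, FreeGroup.map_lift_apply]
      refine DFunLike.congr_fun (?_ : _ = (1 : FreeGroup (Fin m) →* _)) (u j)
      ext; simp
    have h2 : FreeGroup.lift
        (Sum.elim (fun _ : Fin m => 1) fun i => Abelianization.of (FreeGroup.of i))
        (FreeGroup.map Sum.inr (v j)) = (1 : Abelianization (FreeGroup (Fin n))) := by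
      rw [FreeGroup.map_eq_lift, FreeGroup.map_lift_apply]
      have hof : FreeGroup.lift (Sum.elim (fun _ : Fin m => 1) fun i =>
          Abelianization.of (FreeGroup.of i)) ∘ FreeGroup.of ∘ Sum.inr =
          (Abelianization.of : FreeGroup (Fin n) →* _) ∘ FreeGroup.of := by
        ext; simp
      rw [hof, ← FreeGroup.map_lift_apply, ← MonoidHom.mem_ker, Abelianization.ker_of]
      rw [FreeGroup.lift_of_eq_id]
      exact hv j
    rw [map_mul, h1, h2, one_mul]
  · have h1 : FreeGroup.lift (Sum.elim (φ ∘ p) x) (FreeGroup.map Sum.inl (u j)) = φ (a j) := by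
      rw [FreeGroup.map_eq_lift, FreeGroup.map_lift_apply, ← hu j, FreeGroup.map_lift_apply]
      congr 2
      ext; simp
    have h2 : FreeGroup.lift (Sum.elim (φ ∘ p) x) (FreeGroup.map Sum.inr (v j)) = c j := by
      rw [FreeGroup.map_eq_lift, FreeGroup.map_lift_apply, ← hvc j]
      congr 2
      ext; simp
    rw [map_mul, h1, h2, hxe j]

/-- If `φ` is a 2-connected surjection, normal generators of its kernel solve a system that is also
solved by the trivial tuple. -/
lemma IsTwoConnected.exists_system_ker {P G : Type u} [Group P] [Group G] {q : P →* G}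
    (hq : IsTwoConnected R q) (hs : Function.Surjective q) (hP : Group.FG P) {n : ℕ}
    (x : Fin n → P) (hx : Subgroup.normalClosure (Set.range x) = q.ker) :
    ∃ (m : ℕ) (p : Fin m → P) (w : Fin n → FreeGroup (Fin m ⊕ Fin n)) (e : Fin n → ℤ)
      (he : ∀ j, e j ∈ invertibleIntegers R) (hw : _),
      (SystemShape.mk m n e w he hw).IsSolution p x ∧
      (SystemShape.mk m n e w he hw).IsSolution p fun _ => 1 := by
  obtain ⟨m, p, hp⟩ := hP.exists_fin_generators
  have hxker (j : Fin n) : q (x j) = 1 := by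
    have : x j ∈ q.ker := hx ▸ Subgroup.subset_normalClosure ⟨j, rfl⟩
    exact this
  choose e he hxe using fun j => hq.exists_zpow_mem_commutator hs (hxker j)
  let ev : FreeGroup (Fin m ⊕ Fin n) →* P := FreeGroup.lift (Sum.elim p x)
  have hev : Function.Surjective ev := fun y => by
    obtain ⟨w, rfl⟩ := hp y
    refine ⟨FreeGroup.map Sum.inl w, ?_⟩
    simp only [ev]
    rw [FreeGroup.map_eq_lift, FreeGroup.map_lift_apply]
    congr 2
    ext; simp
  let N : Subgroup (FreeGroup (Fin m ⊕ Fin n)) :=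
    Subgroup.normalClosure (Set.range fun j => FreeGroup.of (Sum.inr j))
  have hN : N.map ev = q.ker := by
    rw [Subgroup.map_normalClosure _ _ hev, ← hx, ← Set.range_comp]
    congr 2
    ext; simp [ev]
  have hcomm : ⁅q.ker, (⊤ : Subgroup P)⁆ = (⁅N, (⊤ : Subgroup (FreeGroup _))⁆).map ev := by
    rw [Subgroup.map_commutator, hN, Subgroup.map_top_of_surjective _ hev]
  choose w hw hwx using fun j => show x j ^ e j ∈ (⁅N, (⊤ : Subgroup (FreeGroup _))⁆).map ev from
    hcomm ▸ hxe j
  refine ⟨m, p, w, e, he, fun j => ?_, fun j => (hwx j).symm, fun j => ?_⟩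
  · have : ⁅N, (⊤ : Subgroup (FreeGroup _))⁆ ≤ commutator _ :=
      Subgroup.commutator_mono le_top le_rfl
    exact (this.trans (Abelianization.commutator_subset_ker _)) (hw j)
  · have : ⁅N, (⊤ : Subgroup (FreeGroup (Fin m ⊕ Fin n)))⁆ ≤
        (FreeGroup.lift (Sum.elim p fun _ : Fin n => 1)).ker := by
      refine (Subgroup.commutator_le_left _ _).trans (Subgroup.normalClosure_le_normal ?_)
      rintro _ ⟨j, rfl⟩
      simp [MonoidHom.mem_ker]
    rw [one_zpow]
    exact (MonoidHom.mem_ker.1 (this (hw j))).symm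

/-- Closed groups are local with respect to 2-connected homomorphisms from finitely generated to
finitely presented groups. Existence of solutions extends a homomorphism over the group obtained
from `π` by adjoining generators of `G`; uniqueness of solutions makes the extension trivial on
the kernel of the resulting surjection to `G`. -/
theorem IsRClosed.bijective_comp {A : Type*} [Group A] (hA : IsRClosed R A) {π G : Type u} [Group π]
    [Group G] {φ : π →* G} (hφ : IsTwoConnected R φ) (hπ : Group.FG π)
    (hG : Group.IsFinitelyPresented G) :
    Function.Bijective fun f : G →* A => f.comp φ := by
  obtain ⟨n, x, hx⟩ := hG.fg.exists_fin_generators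
  obtain ⟨m, p, w, e, he, hw, hsol⟩ := hφ.exists_system hπ x hx
  set S := SystemShape.mk m n e w he hw
  refine ⟨fun f g hfg => ?_, fun f => ?_⟩
  · refine MonoidHom.ext_of_freeGroup_lift hx ((hA S (f.comp φ ∘ p)).unique (hsol.map f) ?_)
    have := hsol.map g
    have hfg : f.comp φ = g.comp φ := hfg
    rw [hfg]
    exact this
  · obtain ⟨y, hy, -⟩ := hA S (f ∘ p)
    obtain ⟨f', hf', -⟩ := SystemShape.Adjoin.exists_lift (S := S) f hy
    obtain ⟨q, hq, hqx⟩ := SystemShape.Adjoin.exists_lift (S := S) φ hsol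
    have hqs : Function.Surjective q := fun g => by
      obtain ⟨v, rfl⟩ := hx g
      exact ⟨FreeGroup.lift (S.root p) v, by rw [FreeGroup.map_lift_apply, hqx]⟩
    have hq2 : IsTwoConnected R q :=
      IsTwoConnected.of_comp (hq ▸ hφ) SystemShape.isTwoConnected_toAdjoin
    have hfg := SystemShape.Adjoin.group_fg (S := S) (p := p) hπ
    obtain ⟨k, z, hz⟩ := Group.IsFinitelyPresented.exists_normalClosure_eq_ker hfg hG hqs
    obtain ⟨m', p', w', e', he', hw', hsz, hs1⟩ := hq2.exists_system_ker hqs hfg z hz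
    have hzf := (hA _ _).unique (hsz.map f') (hs1.map f')
    have hker : q.ker ≤ f'.ker := by
      rw [← hz]
      refine Subgroup.normalClosure_le_normal ?_
      rintro _ ⟨j, rfl⟩
      simpa using congrFun hzf j
    refine ⟨q.liftOfSurjective hqs ⟨f', hker⟩, ?_⟩
    have : (q.liftOfSurjective hqs ⟨f', hker⟩).comp q = f' :=
      q.liftOfRightInverse_comp _ _ ⟨f', hker⟩
    change (q.liftOfSurjective hqs ⟨f', hker⟩).comp φ = f
    rw [← hq, ← MonoidHom.comp_assoc, this, hf']

/-! ### The closure of a group -/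

/-- Formal expressions in elements of `G`, the group operations, and solutions of systems. -/
inductive ClosureTerm (R : Subring ℚ) (G : Type u) : Type u
  /-- An element of the group. -/
  | of (g : G) : ClosureTerm R G
  /-- The neutral element. -/
  | one : ClosureTerm R G
  /-- A product. -/
  | mul (s t : ClosureTerm R G) : ClosureTerm R G
  /-- An inverse. -/
  | inv (t : ClosureTerm R G) : ClosureTerm R G
  /-- A coordinate of the solution of a system. -/
  | sol (S : SystemShape R) (p : Fin S.m → ClosureTerm R G) (j : Fin S.n) : ClosureTerm R G

/-- The value of an expression in a closed group. -/
noncomputable def ClosureTerm.eval {G A : Type*} [Group A] (hA : IsRClosed R A) (f : G → A) :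
    ClosureTerm R G → A
  | .of g => f g
  | .one => 1
  | .mul s t => s.eval hA f * t.eval hA f
  | .inv t => (t.eval hA f)⁻¹
  | .sol S p j => (hA S fun i => (p i).eval hA f).choose j

section RClosure

variable (R) (G : Type u) [Group G]

/-- Two expressions are identified if they take the same value under every homomorphism to a closed
group. -/
instance closureSetoid : Setoid (ClosureTerm R G) where
  r s t := ∀ (A : Type u) [Group A] (hA : IsRClosed R A) (f : G →* A), s.eval hA f = t.eval hA f
  iseqv := ⟨fun _ _ _ _ _ => rfl, fun h A _ hA f => (h A hA f).symm,
    fun h h' A _ hA f => (h A hA f).trans (h' A hA f)⟩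

/-- The `R`-closure of a group: the initial closed group under it. -/
def RClosure : Type u := Quotient (closureSetoid R G)

namespace RClosure

variable {R G}

/-- The element of the closure named by an expression. -/
def mk (t : ClosureTerm R G) : RClosure R G := Quotient.mk _ t

lemma mk_surjective : Function.Surjective (mk : ClosureTerm R G → RClosure R G) :=
  Quotient.mk_surjective

/-- Evaluation of elements of the closure under a homomorphism to a closed group. -/
noncomputable def eval {A : Type u} [Group A] (hA : IsRClosed R A) (f : G →* A) :
    RClosure R G → A :=
  Quotient.lift (ClosureTerm.eval hA f) fun _ _ h => h A hA f

lemma ext_eval {x y : RClosure R G}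
    (h : ∀ (A : Type u) [Group A] (hA : IsRClosed R A) (f : G →* A), eval hA f x = eval hA f y) :
    x = y := by
  induction x using Quotient.inductionOn
  induction y using Quotient.inductionOn
  exact Quotient.sound h

instance : One (RClosure R G) := ⟨Quotient.mk _ .one⟩

instance : Mul (RClosure R G) := ⟨Quotient.map₂ .mul fun _ _ h _ _ h' A _ hA f =>
  congrArg₂ (· * ·) (h A hA f) (h' A hA f)⟩

instance : Inv (RClosure R G) := ⟨Quotient.map .inv fun _ _ h A _ hA f =>
  congrArg (·⁻¹) (h A hA f)⟩

lemma eval_one {A : Type u} [Group A] (hA : IsRClosed R A) (f : G →* A) :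
    eval hA f 1 = 1 := rfl

lemma eval_mul {A : Type u} [Group A] (hA : IsRClosed R A) (f : G →* A) (x y : RClosure R G) :
    eval hA f (x * y) = eval hA f x * eval hA f y := by
  induction x using Quotient.inductionOn
  induction y using Quotient.inductionOn
  rfl

lemma eval_inv {A : Type u} [Group A] (hA : IsRClosed R A) (f : G →* A) (x : RClosure R G) :
    eval hA f x⁻¹ = (eval hA f x)⁻¹ := by
  induction x using Quotient.inductionOn
  rfl

instance : Group (RClosure R G) :=
  Group.ofLeftAxioms
    (fun x y z => ext_eval fun A _ hA f => by simp only [eval_mul, mul_assoc])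
    (fun x => ext_eval fun A _ hA f => by simp only [eval_mul, eval_one, one_mul])
    (fun x => ext_eval fun A _ hA f => by simp only [eval_mul, eval_inv, eval_one, inv_mul_cancel])

/-- The homomorphism from the closure to a closed group induced by a homomorphism from `G`. -/
noncomputable def lift {A : Type u} [Group A] (hA : IsRClosed R A) (f : G →* A) :
    RClosure R G →* A :=
  MonoidHom.mk' (eval hA f) (eval_mul hA f)

variable (R) in
/-- The canonical map of a group to its closure. -/
def of : G →* RClosure R G :=
  MonoidHom.mk' (fun g => Quotient.mk _ (.of g)) fun g h => ext_eval fun _ _ _ f => map_mul f g h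

lemma isSolution_iff_lift {S : SystemShape R} {p : Fin S.m → RClosure R G}
    {x : Fin S.n → RClosure R G} : S.IsSolution p x ↔
      ∀ (A : Type u) [Group A] (hA : IsRClosed R A) (f : G →* A),
        S.IsSolution (lift hA f ∘ p) (lift hA f ∘ x) := by
  refine ⟨fun h A _ hA f => h.map _, fun h j => ext_eval fun A _ hA f => ?_⟩
  have := h A hA f j
  rw [← Sum.comp_elim, ← FreeGroup.map_lift_apply] at this
  change lift hA f _ = lift hA f _
  rw [← this, map_zpow]
  rfl

lemma isSolution_sol (S : SystemShape R) (t : Fin S.m → ClosureTerm R G) :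
    S.IsSolution (fun i => mk (t i) : Fin S.m → RClosure R G)
      fun j => mk (.sol S t j) :=
  isSolution_iff_lift.2 fun _ _ hA f => (hA S fun i => (t i).eval hA f).choose_spec.1

variable (R G) in
lemma isRClosed : IsRClosed R (RClosure R G) := fun S p => by
  choose t ht using fun i => mk_surjective (p i)
  obtain rfl : (fun i => mk (t i)) = p := funext ht
  refine ⟨_, isSolution_sol S t, fun x hx => ?_⟩
  funext j
  refine ext_eval fun A _ hA f => ?_
  exact congrFun ((hA S _).unique ((hx.map (lift hA f))) ((isSolution_sol S t).map (lift hA f))) j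

lemma hom_ext {A : Type u} [Group A] (hA : IsRClosed R A) {f g : RClosure R G →* A}
    (h : f.comp (of R) = g.comp (of R)) : f = g := by
  ext x
  obtain ⟨t, rfl⟩ := mk_surjective x
  induction t with
  | of a => exact DFunLike.congr_fun h a
  | one => exact (map_one f).trans (map_one g).symm
  | mul s t hs ht => exact (map_mul f _ _).trans ((congrArg₂ _ hs ht).trans (map_mul g _ _).symm)
  | inv t ht => exact (map_inv f _).trans ((congrArg _ ht).trans (map_inv g _).symm)
  | sol S t j ht =>
    have hf := (isSolution_sol S t).map f
    have hg := (isSolution_sol S t).map g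
    have hfg : f ∘ (fun i => mk (t i)) =
        g ∘ fun i => mk (t i) := funext ht
    rw [hfg] at hf
    exact congrFun ((hA S _).unique hf hg) j

end RClosure

end RClosure

end Closed

/-! ### Exhausting all systems along a sequence -/

section Sequence

variable (R : Subring ℚ)

/-- A system over `G` together with two candidate solutions: the datum of one step in the
construction of the closure. -/
structure SolvingTask (G : Type u) where
  /-- The shape of the system. -/
  shape : SystemShape R
  /-- The coefficients. -/
  coeff : Fin shape.m → G
  /-- The first candidate solution. -/
  fst : Fin shape.n → G
  /-- The second candidate solution. -/
  snd : Fin shape.n → G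

variable {R}

/-- Transport of a task along a map. -/
def SolvingTask.map {G H : Type u} (φ : G → H) (t : SolvingTask R G) : SolvingTask R H :=
  ⟨t.shape, φ ∘ t.coeff, φ ∘ t.fst, φ ∘ t.snd⟩

/-- A homomorphism settles a task if the system has a solution in its target, and the candidates,
if they are solutions, become equal there. -/
def SolvingTask.IsSettled {G H : Type u} [Group G] [Group H] (t : SolvingTask R G) (φ : G →* H) :
    Prop :=
  (∃ z, t.shape.IsSolution (φ ∘ t.coeff) z) ∧
    (t.shape.IsSolution t.coeff t.fst → t.shape.IsSolution t.coeff t.snd → φ ∘ t.fst = φ ∘ t.snd)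

lemma SolvingTask.IsSettled.of_map {G H K : Type u} [Group G] [Group H] [Group K]
    {t : SolvingTask R G} {φ : G →* H} {ψ : H →* K} (h : (t.map φ).IsSettled ψ) :
    t.IsSettled (ψ.comp φ) :=
  ⟨h.1, fun hx hy => h.2 (hx.map φ) (hy.map φ)⟩

lemma exists_surjective_solvingTask {G : Type u} [Group G] (hG : Group.IsFinitelyPresented G) :
    ∃ f : ℕ → SolvingTask R G, Function.Surjective f := by
  have := hG.countable
  have : Countable (SolvingTask R G) := by
    let F : SolvingTask R G → Σ S : SystemShape R, (Fin S.m → G) × (Fin S.n → G) × (Fin S.n → G) :=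
      fun t => ⟨t.shape, t.coeff, t.fst, t.snd⟩
    refine Function.LeftInverse.injective (f := F)
      (g := fun t => ⟨t.1, t.2.1, t.2.2.1, t.2.2.2⟩) (fun _ => rfl) |>.countable
  have : Nonempty (SolvingTask R G) :=
    ⟨⟨⟨0, 0, Fin.elim0, Fin.elim0, fun j => j.elim0, fun j => j.elim0⟩,
      Fin.elim0, Fin.elim0, Fin.elim0⟩⟩
  exact exists_surjective_nat _

variable (R) in
/-- A stage of the construction: a finitely presented group with a doubly indexed family of tasks,
in which row `a` consists of the tasks that arose at stage `a`. Rows of later stages hold arbitrary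
tasks until that stage overwrites them. -/
structure SolvingStage where
  /-- The group. -/
  grp : GrpCat.{u}
  fp : Group.IsFinitelyPresented grp
  /-- The tasks. -/
  tasks : ℕ → ℕ → SolvingTask R grp

/-- One step: settle a task, transport the others, and list all tasks of the new group in a new
row. -/
lemma SolvingStage.exists_next (T : SolvingStage.{u} R) (k : ℕ) :
    ∃ (T' : SolvingStage.{u} R) (φ : T.grp ⟶ T'.grp), OmegaR R φ ∧
      (T.tasks k.unpair.1 k.unpair.2).IsSettled φ.hom ∧
      (∀ a, a ≠ k + 1 → ∀ b, T'.tasks a b = (T.tasks a b).map φ) ∧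
      Function.Surjective (T'.tasks (k + 1)) := by
  let t := T.tasks k.unpair.1 k.unpair.2
  obtain ⟨H, _, φ, hH, hφ, hsol, heq⟩ := exists_omegaR_solve t.shape T.fp t.coeff t.fst t.snd
  obtain ⟨f, hf⟩ := exists_surjective_solvingTask (R := R) hH
  refine ⟨⟨GrpCat.of H, hH, fun a b => if a = k + 1 then f b else (T.tasks a b).map φ⟩,
    GrpCat.ofHom φ, ⟨T.fp.fg, hH, hφ⟩, ⟨hsol, heq⟩, fun a ha b => if_neg ha, ?_⟩
  simpa using hf

/-- A finitely presented group starts a sequence of finitely presented groups and 2-connected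
homomorphisms along which every task arising at any stage is eventually settled. -/
theorem exists_solving_sequence (G : GrpCat.{u}) (hG : Group.IsFinitelyPresented G) :
    ∃ (P : ℕ ⥤ GrpCat.{u}) (_ : G = P.obj 0),
      (∀ k : ℕ, Group.IsFinitelyPresented (P.obj k)) ∧
      (∀ k : ℕ, OmegaR R (P.map (homOfLE (Nat.le_succ k)))) ∧
      ∀ (l : ℕ) (t : SolvingTask R (P.obj l)), ∃ (k : ℕ) (h : l ≤ k),
        t.IsSettled (P.map (homOfLE h)).hom := by
  choose next φ hΩ hset htasks hsurj using SolvingStage.exists_next.{u} (R := R)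
  obtain ⟨f, hf⟩ := exists_surjective_solvingTask (R := R) hG
  let T : ℕ → SolvingStage.{u} R := fun k => Nat.rec ⟨G, hG, fun _ => f⟩ (fun k T => next T k) k
  let P : ℕ ⥤ GrpCat.{u} := Functor.ofSequence (X := fun k => (T k).grp) fun k => φ (T k) k
  have hP (k : ℕ) : P.map (homOfLE (Nat.le_succ k)) = φ (T k) k :=
    Functor.ofSequence_map_homOfLE_succ _ k
  have hcomp (l k : ℕ) (h : l ≤ k) :
      P.map (homOfLE (h.trans (Nat.le_succ k))) = P.map (homOfLE h) ≫ φ (T k) k :=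
    (P.map_comp (homOfLE h) (homOfLE (Nat.le_succ k))).trans
      (congrArg (P.map (homOfLE h) ≫ ·) (hP k))
  have hrow (l : ℕ) : Function.Surjective ((T l).tasks l) := by
    cases l with
    | zero => exact hf
    | succ l => exact hsurj (T l) l
  have hmap (l : ℕ) (b : ℕ) (k : ℕ) (h : l ≤ k) :
      (T k).tasks l b = ((T l).tasks l b).map (P.map (homOfLE h)) := by
    induction k, h using Nat.le_induction with
    | base =>
      have : P.map (homOfLE le_rfl) = 𝟙 (P.obj l) := P.map_id l
      rw [this]
      rfl
    | succ k h ih =>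
      rw [hcomp l k h]
      refine (htasks (T k) k l (by omega) b).trans ?_
      rw [ih]
      rfl
  refine ⟨P, rfl, fun k => (T k).fp, fun k => hP k ▸ hΩ (T k) k, fun l t => ?_⟩
  obtain ⟨b, rfl⟩ := hrow l t
  have hl : l ≤ Nat.pair l b := Nat.left_le_pair l b
  refine ⟨Nat.pair l b + 1, hl.trans (Nat.le_succ _), ?_⟩
  have h := hset (T (Nat.pair l b)) (Nat.pair l b)
  rw [Nat.unpair_pair, hmap l b _ hl] at h
  rw [hcomp l _ hl]
  exact SolvingTask.IsSettled.of_map (φ := (P.map (homOfLE hl)).hom) h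

end Sequence

/-! ### The colimit of the sequence -/

section Colimit

variable {R : Subring ℚ}

instance : Limits.PreservesColimitsOfShape ℕ (forget GrpCat.{u}) :=
  have := Limits.preservesFilteredColimitsOfSize_shrink.{0, u, 0, u} (forget GrpCat.{u})
  Limits.PreservesFilteredColimitsOfSize.preserves_filtered_colimits ℕ

instance : Limits.HasColimitsOfShape ℕ GrpCat.{u} :=
  ⟨fun F => ⟨⟨⟨_, GrpCat.FilteredColimits.colimitCoconeIsColimit.{0, u} F⟩⟩⟩⟩

variable {P : ℕ ⥤ GrpCat.{u}} {D : Limits.Cocone P}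

lemma cocone_ι_comp_map (D : Limits.Cocone P) {l k : ℕ} (h : l ≤ k) {ι : Type*} (x : ι → P.obj l) :
    D.ι.app k ∘ P.map (homOfLE h) ∘ x = D.ι.app l ∘ x :=
  funext fun i => congrArg (fun F => F.hom (x i)) (D.w (homOfLE h))

lemma map_comp_map_comp (P : ℕ ⥤ GrpCat.{u}) {l k m : ℕ} (h : l ≤ k) (h' : k ≤ m) {ι : Type*}
    (x : ι → P.obj l) :
    P.map (homOfLE h') ∘ P.map (homOfLE h) ∘ x = P.map (homOfLE (h.trans h')) ∘ x :=
  funext fun i => congrArg (fun F => F.hom (x i)) (P.map_comp (homOfLE h) (homOfLE h')).symm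

/-- A finite tuple in the colimit of a sequence comes from a stage, which may be taken arbitrarily
late. -/
lemma exists_rep_of_fin (hD : Limits.IsColimit D) {n : ℕ} (x : Fin n → D.pt) :
    ∃ L, ∀ l, L ≤ l → ∃ y : Fin n → P.obj l, D.ι.app l ∘ y = x := by
  choose l y hy using fun i => Limits.Concrete.isColimit_exists_rep P hD (x i)
  obtain ⟨L, hL⟩ := (Set.finite_range l).bddAbove
  have hL (i : Fin n) : l i ≤ L := hL ⟨i, rfl⟩
  refine ⟨L, fun k hk => ⟨fun i => P.map (homOfLE ((hL i).trans hk)) (y i), ?_⟩⟩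
  funext i
  rw [← hy i]
  exact congrArg (fun F => F.hom (y i)) (D.w (homOfLE ((hL i).trans hk)))

/-- Finitely many equalities in the colimit of a sequence hold at all late stages. -/
lemma exists_map_eq_of_fin (hD : Limits.IsColimit D) {l n : ℕ} {x y : Fin n → P.obj l}
    (hxy : D.ι.app l ∘ x = D.ι.app l ∘ y) :
    ∃ (k : ℕ) (h : l ≤ k), P.map (homOfLE h) ∘ x = P.map (homOfLE h) ∘ y := by
  choose k f g hfg using fun i =>
    Limits.Concrete.isColimit_exists_of_rep_eq P hD (x i) (y i) (congrFun hxy i)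
  obtain ⟨L, hL⟩ := (Set.finite_range k).bddAbove
  have hL (i : Fin n) : k i ≤ L := hL ⟨i, rfl⟩
  refine ⟨max l L, le_max_left _ _, ?_⟩
  funext i
  have hk : k i ≤ max l L := (hL i).trans (le_max_right _ _)
  have h1 : P.map (homOfLE (le_max_left l L)) = P.map (f i) ≫ P.map (homOfLE hk) := by
    rw [← P.map_comp]
    rfl
  have h2 := hfg i
  rw [Subsingleton.elim (g i) (f i)] at h2
  rw [h1]
  exact congrArg (P.map (homOfLE hk)) h2

lemma SystemShape.exists_isSolution_map {R : Subring ℚ} (hD : Limits.IsColimit D)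
    {S : SystemShape R} {l : ℕ} {p : Fin S.m → P.obj l} {x : Fin S.n → P.obj l}
    (h : S.IsSolution (D.ι.app l ∘ p) (D.ι.app l ∘ x)) :
    ∃ k₀, ∀ k, k₀ ≤ k → ∃ h : l ≤ k,
      S.IsSolution (P.map (homOfLE h) ∘ p) (P.map (homOfLE h) ∘ x) := by
  obtain ⟨k, hk, heq⟩ := exists_map_eq_of_fin hD (x := fun j => x j ^ S.exp j)
      (y := fun j => FreeGroup.lift (Sum.elim p x) (S.word j)) (by
    funext j
    have := h j
    rw [← Sum.comp_elim, Function.comp_apply] at this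
    exact (map_zpow (D.ι.app l).hom _ _).trans
      (this.trans (FreeGroup.map_lift_apply (D.ι.app l).hom _ _).symm))
  have hsol : S.IsSolution (P.map (homOfLE hk) ∘ p) (P.map (homOfLE hk) ∘ x) := fun j => by
    have := congrFun heq j
    rw [← Sum.comp_elim]
    exact (map_zpow (P.map (homOfLE hk)).hom _ _).symm.trans
      (this.trans (FreeGroup.map_lift_apply (P.map (homOfLE hk)).hom _ _))
  refine ⟨k, fun k' hk' => ⟨hk.trans hk', ?_⟩⟩
  rw [← map_comp_map_comp P hk hk', ← map_comp_map_comp P hk hk']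
  exact hsol.map (P.map (homOfLE hk')).hom

/-- The colimit of a sequence along which all tasks are settled is closed. -/
lemma isRClosed_colimit {R : Subring ℚ} (hD : Limits.IsColimit D)
    (hP : ∀ (l : ℕ) (t : SolvingTask R (P.obj l)), ∃ (k : ℕ) (h : l ≤ k),
      t.IsSettled (P.map (homOfLE h)).hom) : IsRClosed R D.pt := by
  intro S p
  refine existsUnique_of_exists_of_unique ?_ fun x y hx hy => ?_
  · obtain ⟨l, hl⟩ := exists_rep_of_fin hD p
    obtain ⟨p, rfl⟩ := hl l le_rfl
    obtain ⟨k, hk, ⟨z, hz⟩, -⟩ := hP l ⟨S, p, fun _ => 1, fun _ => 1⟩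
    refine ⟨D.ι.app k ∘ z, ?_⟩
    rw [← cocone_ι_comp_map D hk]
    exact hz.map (D.ι.app k).hom
  · obtain ⟨l₁, hl₁⟩ := exists_rep_of_fin hD p
    obtain ⟨l₂, hl₂⟩ := exists_rep_of_fin hD x
    obtain ⟨l₃, hl₃⟩ := exists_rep_of_fin hD y
    obtain ⟨p, rfl⟩ := hl₁ (l₁ + l₂ + l₃) (by omega)
    obtain ⟨x, rfl⟩ := hl₂ (l₁ + l₂ + l₃) (by omega)
    obtain ⟨y, rfl⟩ := hl₃ (l₁ + l₂ + l₃) (by omega)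
    obtain ⟨k₁, hk₁⟩ := SystemShape.exists_isSolution_map hD hx
    obtain ⟨k₂, hk₂⟩ := SystemShape.exists_isSolution_map hD hy
    obtain ⟨hm, hx⟩ := hk₁ (max k₁ k₂) (le_max_left _ _)
    obtain ⟨_, hy⟩ := hk₂ (max k₁ k₂) (le_max_right _ _)
    obtain ⟨k, hk, -, heq⟩ := hP _ ⟨S, _, _, _⟩
    have h := (cocone_ι_comp_map D hk _).symm.trans
      ((congrArg (D.ι.app k ∘ ·) (heq hx hy)).trans (cocone_ι_comp_map D hk _))
    exact (cocone_ι_comp_map D hm x).symm.trans (h.trans (cocone_ι_comp_map D hm y))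

/-- Homomorphisms to a closed group extend uniquely along a sequence of maps in `Ω^R`. -/
lemma IsRClosed.bijective_comp_map_sequence {R : Subring ℚ} {A : Type*} [Group A]
    (hA : IsRClosed R A) (hP : ∀ k : ℕ, OmegaR R (P.map (homOfLE (Nat.le_succ k)))) (k : ℕ) :
    Function.Bijective fun f : P.obj k →* A => f.comp (P.map (homOfLE (Nat.zero_le k))).hom := by
  induction k with
  | zero =>
    have h0 : P.map (homOfLE (Nat.zero_le 0)) = 𝟙 (P.obj 0) := P.map_id 0
    rw [h0]
    exact Function.bijective_id
  | succ k ih =>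
    have hk := hA.bijective_comp (hP k).2.2 (hP k).1 (hP k).2.1
    have hcomp : P.map (homOfLE (Nat.zero_le (k + 1))) =
        P.map (homOfLE (Nat.zero_le k)) ≫ P.map (homOfLE (Nat.le_succ k)) :=
      P.map_comp (homOfLE (Nat.zero_le k)) (homOfLE (Nat.le_succ k))
    rw [hcomp]
    exact ih.comp hk

/-- Homomorphisms to a closed group extend uniquely from the start of a sequence of maps in `Ω^R` to
its colimit. -/
lemma IsRClosed.bijective_comp_colimit {R : Subring ℚ} {A : Type u} [Group A]
    (hA : IsRClosed R A) (hP : ∀ k : ℕ, OmegaR R (P.map (homOfLE (Nat.le_succ k))))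
    (hD : Limits.IsColimit D) :
    Function.Bijective fun f : D.pt →* A => f.comp (D.ι.app 0).hom := by
  have hbij := hA.bijective_comp_map_sequence hP
  have hw (l k : ℕ) (h : l ≤ k) : (D.ι.app k).hom.comp (P.map (homOfLE h)).hom = (D.ι.app l).hom :=
    congrArg GrpCat.Hom.hom (D.w (homOfLE h))
  refine ⟨fun f g hfg => ?_, fun f => ?_⟩
  · have hfg : f.comp (D.ι.app 0).hom = g.comp (D.ι.app 0).hom := hfg
    have : GrpCat.ofHom (Y := A) f = GrpCat.ofHom (Y := A) g := hD.hom_ext fun k =>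
      GrpCat.hom_ext ((hbij k).1 (by
        change (f.comp (D.ι.app k).hom).comp _ = (g.comp (D.ι.app k).hom).comp _
        rw [MonoidHom.comp_assoc, MonoidHom.comp_assoc, hw, hfg]))
    exact congrArg GrpCat.Hom.hom this
  · choose F hF using fun k => (hbij k).2 f
    let C : Limits.Cocone P := ⟨GrpCat.of A, ⟨fun k => GrpCat.ofHom (F k), fun l k h => by
      refine GrpCat.hom_ext ((hbij l).1 ?_)
      have hl : P.map (homOfLE (Nat.zero_le k)) =
          P.map (homOfLE (Nat.zero_le l)) ≫ P.map (homOfLE (leOfHom h)) :=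
        P.map_comp (homOfLE (Nat.zero_le l)) (homOfLE (leOfHom h))
      have hk := hF k
      rw [hl] at hk
      exact hk.trans (hF l).symm⟩⟩
    refine ⟨(hD.desc C).hom, ?_⟩
    have h0 : (hD.desc C).hom.comp (D.ι.app 0).hom = F 0 :=
      congrArg GrpCat.Hom.hom (hD.fac C 0)
    have hid : P.map (homOfLE (Nat.zero_le 0)) = 𝟙 (P.obj 0) := P.map_id 0
    have hF0 := hF 0
    rw [hid] at hF0
    exact h0.trans hF0

end Colimit

/-! ### The closure functor -/

section Functor

variable (R : Subring ℚ)

/-- The `R`-closure as an endofunctor of the category of groups. -/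
noncomputable def rClosureFunctor : GrpCat.{u} ⥤ GrpCat.{u} where
  obj G := GrpCat.of (RClosure R G)
  map {_ H} f := GrpCat.ofHom
    (RClosure.lift (RClosure.isRClosed R H) ((RClosure.of R).comp f.hom))
  map_id _ := GrpCat.hom_ext (RClosure.hom_ext (RClosure.isRClosed R _) rfl)
  map_comp _ _ := GrpCat.hom_ext (RClosure.hom_ext (RClosure.isRClosed R _) rfl)

/-- The natural transformation from the identity to the closure. -/
noncomputable def rClosureUnit : 𝟭 GrpCat.{u} ⟶ rClosureFunctor R where
  app _ := GrpCat.ofHom (RClosure.of R)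
  naturality _ _ _ := rfl

variable {R}

/-- The closure inverts the homomorphisms to which closed groups are local. -/
lemma isIso_rClosureFunctor_map {π G : GrpCat.{u}} {α : π ⟶ G} (hα : OmegaR R α) :
    IsIso ((rClosureFunctor R).map α) := by
  have hbij {A : Type u} [Group A] (hA : IsRClosed R A) := hA.bijective_comp hα.2.2 hα.1 hα.2.1
  obtain ⟨l, hl⟩ := (hbij (RClosure.isRClosed R π)).2 (RClosure.of R)
  refine ⟨GrpCat.ofHom (RClosure.lift (RClosure.isRClosed R π) l), GrpCat.hom_ext
    (RClosure.hom_ext (RClosure.isRClosed R π) hl), GrpCat.hom_ext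
    (RClosure.hom_ext (RClosure.isRClosed R G) ((hbij (RClosure.isRClosed R G)).1 ?_))⟩
  exact congrArg (fun f : π →* RClosure R π =>
    (RClosure.lift (RClosure.isRClosed R G) ((RClosure.of R).comp α.hom)).comp f) hl

end Functor

theorem mainTheorem5 (R : Subring ℚ) :
    ∃ (E : GrpCat.{u} ⥤ GrpCat.{u}) (i : 𝟭 GrpCat.{u} ⟶ E),
      (∀ (π G : GrpCat.{u}) (α : π ⟶ G), OmegaR R α → IsIso (E.map α)) ∧
      (∀ G : GrpCat.{u}, Group.IsFinitelyPresented G →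
        ∃ (P : ℕ ⥤ GrpCat.{u}) (h0 : G = P.obj 0) (c : P ⟶ (Functor.const ℕ).obj (E.obj G)),
          (∀ k : ℕ, Group.IsFinitelyPresented (P.obj k)) ∧
          (∀ k : ℕ, OmegaR R (P.map (homOfLE (Nat.le_succ k)))) ∧
          Nonempty (Limits.IsColimit (Limits.Cocone.mk (E.obj G) c)) ∧
          i.app G = eqToHom h0 ≫ c.app 0) := by
  refine ⟨rClosureFunctor R, rClosureUnit R, fun π G α hα => isIso_rClosureFunctor_map hα,
    fun G hG => ?_⟩
  obtain ⟨P, h0, hfp, hΩ, hP⟩ := exists_solving_sequence (R := R) G hG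
  subst h0
  let D := Limits.colimit.cocone P
  have hD : Limits.IsColimit D := Limits.colimit.isColimit P
  have hDc : IsRClosed R D.pt := isRClosed_colimit hD hP
  have hcl := RClosure.isRClosed R (P.obj 0)
  -- the colimit and the closure are both initial among closed groups under the first group
  obtain ⟨g, hg⟩ := (hcl.bijective_comp_colimit hΩ hD).2 (RClosure.of R)
  let f : RClosure R (P.obj 0) →* D.pt := RClosure.lift hDc (D.ι.app 0).hom
  have hgf : g.comp f = MonoidHom.id _ := RClosure.hom_ext hcl hg
  have hfg : f.comp g = MonoidHom.id _ := (hDc.bijective_comp_colimit hΩ hD).1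
    (congrArg (fun h : P.obj 0 →* RClosure R (P.obj 0) => f.comp h) hg)
  let e : D.pt ≅ (rClosureFunctor R).obj (P.obj 0) :=
    ⟨GrpCat.ofHom g, GrpCat.ofHom f, GrpCat.hom_ext hfg, GrpCat.hom_ext hgf⟩
  refine ⟨P, rfl, D.ι ≫ (Functor.const ℕ).map e.hom, hfp, hΩ,
    ⟨hD.ofIsoColimit (Limits.Cocone.ext e fun _ => rfl)⟩, ?_⟩
  exact GrpCat.hom_ext hg.symm
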